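/- Let $\Gamma\subset\mathrm{PSL}_2(\mathbb{R})$ be a Fuchsian group of the first kind, that is, a discrete subgroup such that the quotient $M=\Gamma\backslash\mathbb{H}$ of the upper half-plane has finite hyperbolic area. Points of $M$ are identified with representatives in $\mathbb{H}$. For $z,w\in\mathbb{H}$ let $d_{\mathrm{hyp}}(z,w)$ be the hyperbolic distance and $u(z,w)=\frac{|z-w|^2}{4\,\mathrm{Im}(z)\,\mathrm{Im}(w)}$, so that $\cosh(d_{\mathrm{hyp}}(z,w))=1+2u(z,w)$. For $\mathrm{Re}(s)>1$ and $z\neq w$ in $M$ the hyperbolic Green's function is $$G_s(z,w)=\frac{1}{2\pi}\sum_{\eta\in\Gamma}Q_{s-1}\bigl(1+2u(z,\eta w)\bigr),$$ where $Q_\nu$ is the Legendre function of the second kind, $$Q_\nu(x)=\frac{\sqrt{\pi}\,\Gamma(\nu+1)}{\Gamma(\nu+\frac32)\,(2x)^{\nu+1}}\,F\Bigl(\frac{\nu+2}{2},\frac{\nu+1}{2};\nu+\frac32;\frac1{x^2}\Bigr)\qquad(x>1),$$ and $F={}_2F_1$ is the Gauss hypergeometric function. Put, for $\mathrm{Re}(\nu)>1$,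 $$K_\nu(z,w)=\sum_{\eta\in\Gamma}\cosh(d_{\mathrm{hyp}}(z,\eta w))^{-\nu},\qquad \mathcal{K}_\nu(z,w)=\sum_{k=0}^\infty\frac{b_k(\nu)}{k!}K_{\nu+2k}(z,w),$$ $$b_k(\nu)=\frac{(\frac\nu2)_k\,(\frac{\nu+1}2)_k}{(\nu+\frac12)_k},\qquad c(\nu)=\frac{2^{-\nu-1}\,\Gamma(\nu)}{\Gamma(\nu-\frac12)\,\pi^{3/2}\,i},$$ where $(a)_k$ is the Pochhammer symbol. Let $\delta\in(0,1/2)$, let $z,w\in M$ with $z\neq w$, and let $s\in\mathbb{C}$ with $\mathrm{Re}(s)>1+\delta$ (so for given $s$ with $\mathrm{Re}(s)>1$, any $\delta\in(0,1/2)$ with $\delta<\mathrm{Re}(s)-1$). Then the series defining $G_s(z,w)$ converges absolutely, the series defining $K_{\nu+2k}(z,w)$, $k\ge 0$, and $\mathcal{K}_\nu(z,w)$ converge absolutely for $\mathrm{Re}(\nu)=1+\delta$, and $$G_s(z,w)=\int_{\mathrm{Re}(\nu)=1+\delta}\frac{c(\nu)}{(s-\frac12)^2-(\frac12-\nu)^2}\,\mathcal{K}_\nu(z,w)\,d\nu,$$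 where the integral along the vertical line, oriented upwards, converges absolutely. -/

import Mathlib

open scoped MatrixGroups UpperHalfPlane Nat

noncomputable section

namespace HypGreen

/-- The action of `PSL(2, ℝ)` on the upper half-plane by fractional linear transformations,
obtained from Mathlib's action of `PGL(2, ℝ)` through the inclusion `PSL(2, ℝ) → PGL(2, ℝ)`. -/
instance pslAction : MulAction PSL(2, ℝ) ℍ :=
  MulAction.compHom ℍ (Matrix.ProjectiveSpecialLinearGroup.toPGL (n := Fin 2) (R := ℝ))

/-- The class of a matrix in `SL(2, ℝ)` acts as the matrix itself. -/
theorem psl_mk_smul (g : SL(2, ℝ)) (z : ℍ) : (QuotientGroup.mk g : PSL(2, ℝ)) • z = g • z := rfl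

/-- Fuchsian groups of the first kind: discrete subgroups `Γ` of `PSL(2, ℝ)` such that `Γ \ ℍ` has
finite hyperbolic area, i.e. there is a fundamental domain of finite area. (`volume` on `ℍ` is the
hyperbolic area `dx dy / y ^ 2`.) -/
structure IsFuchsianFirstKind (Γ : Subgroup PSL(2, ℝ)) : Prop where
  discrete : DiscreteTopology Γ
  finite_area : ∃ F : Set ℍ, MeasureTheory.IsFundamentalDomain Γ F MeasureTheory.volume ∧
    MeasureTheory.volume F < ⊤

/-- `u(z, w) = |z - w| ^ 2 / (4 Im z Im w)`. -/
def u (z w : ℍ) : ℝ := ‖(z : ℂ) - (w : ℂ)‖ ^ 2 / (4 * z.im * w.im)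

/-- `cosh (d_hyp(z, w)) = 1 + 2 u(z, w)`; `dist` on `ℍ` is the hyperbolic distance. -/
theorem cosh_dist_eq (z w : ℍ) : Real.cosh (dist z w) = 1 + 2 * u z w := by
  rw [UpperHalfPlane.cosh_dist, u, ← Complex.dist_eq]
  have h₁ := z.im_ne_zero
  have h₂ := w.im_ne_zero
  field_simp
  ring

/-- The Legendre function of the second kind `Q_ν(x)` for real `x > 1`:
`√π Γ(ν + 1) / (Γ(ν + 3/2) (2x) ^ (ν + 1)) · ₂F₁((ν + 2)/2, (ν + 1)/2; ν + 3/2; 1/x ^ 2)`. -/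
def legendreQ (ν : ℂ) (x : ℝ) : ℂ :=
  (Real.sqrt Real.pi : ℂ) * Complex.Gamma (ν + 1) /
      (Complex.Gamma (ν + 3 / 2) * (2 * (x : ℂ)) ^ (ν + 1)) *
    ₂F₁ ((ν + 2) / 2) ((ν + 1) / 2) (ν + 3 / 2) (1 / (x : ℂ) ^ 2)

/-- The hyperbolic Green's function `G_s(z, w) = (1/2π) ∑_{η ∈ Γ} Q_{s-1}(1 + 2 u(z, η w))`. -/
def greens (Γ : Subgroup PSL(2, ℝ)) (s : ℂ) (z w : ℍ) : ℂ :=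
  1 / (2 * (Real.pi : ℂ)) * ∑' η : Γ, legendreQ (s - 1) (1 + 2 * u z (η • w))

/-- The automorphic kernel `K_s(z, w) = ∑_{η ∈ Γ} cosh (d_hyp(z, η w)) ^ (-s)`. -/
def kernelK (Γ : Subgroup PSL(2, ℝ)) (s : ℂ) (z w : ℍ) : ℂ :=
  ∑' η : Γ, (Real.cosh (dist z (η • w)) : ℂ) ^ (-s)

/-- `b_k(ν) = (ν/2)_k ((ν + 1)/2)_k / (ν + 1/2)_k` with the Pochhammer symbol `(a)_k`. -/
def b (k : ℕ) (ν : ℂ) : ℂ :=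
  (ascPochhammer ℂ k).eval (ν / 2) * (ascPochhammer ℂ k).eval ((ν + 1) / 2) /
    (ascPochhammer ℂ k).eval (ν + 1 / 2)

/-- `𝒦_ν(z, w) = ∑_{k ≥ 0} (b_k(ν) / k!) K_{ν + 2k}(z, w)`. -/
def calK (Γ : Subgroup PSL(2, ℝ)) (ν : ℂ) (z w : ℍ) : ℂ :=
  ∑' k : ℕ, b k ν / (k ! : ℂ) * kernelK Γ (ν + 2 * k) z w

/-- `c(ν) = 2 ^ (-ν - 1) Γ(ν) / (Γ(ν - 1/2) π ^ (3/2) i)`. -/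
def c (ν : ℂ) : ℂ :=
  (2 : ℂ) ^ (-ν - 1) * Complex.Gamma ν /
    (Complex.Gamma (ν - 1 / 2) * (Real.pi : ℂ) ^ (3 / 2 : ℂ) * Complex.I)

/-- The contour integral `∫_{Re ν = σ} f(ν) dν` along the vertical line, oriented upwards. -/
def lineIntegral (σ : ℝ) (f : ℂ → ℂ) : ℂ :=
  Complex.I * ∫ t : ℝ, f (σ + t * Complex.I)

/-- The integrand `c(ν) / ((s - 1/2) ^ 2 - (1/2 - ν) ^ 2) · 𝒦_ν(z, w)`. -/
def greensIntegrand (Γ : Subgroup PSL(2, ℝ)) (s : ℂ) (z w : ℍ) (ν : ℂ) : ℂ :=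
  c ν / ((s - 1 / 2) ^ 2 - (1 / 2 - ν) ^ 2) * calK Γ ν z w

end HypGreen

end

/-! Put `λ = ν - 1/2`, `S = s - 1/2` and `a = 1/2 + δ`. For one group element with `d = dist z (η •
w)`, the series over `k` in `calK` is the hypergeometric series of the Legendre function, and `c ν`
is normalized so that the sum is `λ / (2π²i) · Q_{ν-1}(cosh d)` (`hasSum_b_mul_cosh_cpow`). Summed
over the group, the claim becomes a Cauchy formula on the half-plane `Re λ ≥ a`: for `F` holomorphic
there and `O(|λ|^{-1/2})`, the integral over `t` of `λ / (S² - λ²) · F(λ)`, `λ = a + it`, equals `π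
F(S)` (`integral_kernel_mul`). The constants combine to the factor `1 / (2π)` of `greens`.

The decay of `F` is read off from the expansion `Q_{ν-1}(cosh d) = √π ∑ₙ (1/2)ₙ / n! · Γ(ν+n) /
Γ(ν+n+1/2) · e^{-d(ν+2n)}` (`hasSum_legendreTerm`), which follows from a quadratic transformation of
₂F₁ (`quadratic_transformation`). The Gamma ratio is `O(|ν|^{-1/2})` uniformly in `n`
(`exists_norm_gammaRatio_le`, `norm_gammaRatio_add_nat_le`). Cauchy's formula is applied to each
term, and the sum over `Γ × ℕ` is exchanged with the integral by dominated bounds. These rest on the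
convergence of `∑ e^{-σ d(z, ηw)}` for `σ > 1` (`summable_exp_neg_mul_dist`) and on a positive lower
bound for the distances (`exists_forall_le_dist`), which gives geometric decay in `n` and `k`. -/

namespace HypGreen

/-! ### Decay of `Γ(z) / Γ(z + 1/2)` in a right half-plane. -/

section GammaRatio

open Complex Filter Topology

/-- The ratio `Γ(z) / Γ(z + 1/2)`. -/
noncomputable def gammaRatio (z : ℂ) : ℂ := Gamma z / Gamma (z + 1 / 2)

theorem gammaRatio_add_one {z : ℂ} (hz : 0 < z.re) :
    gammaRatio (z + 1) = gammaRatio z * (z / (z + 1 / 2)) := by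
  have h1 : z ≠ 0 := fun h => by simp [h] at hz
  have h2 : z + 1 / 2 ≠ 0 := fun h => by
    have := congrArg Complex.re h
    simp at this
    linarith
  have h3 : Gamma (z + 1 / 2) ≠ 0 := Gamma_ne_zero_of_re_pos (by simp; linarith)
  rw [gammaRatio, gammaRatio, Gamma_add_one z h1, show z + 1 + 1 / 2 = z + 1 / 2 + 1 by ring,
    Gamma_add_one _ h2]
  field_simp

/-- Each unit shift multiplies the ratio by `z / (z + 1/2)`, of modulus at most 1 when `Re z > 0`.
This makes the bounds on the Legendre expansion uniform in `n`. -/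
theorem norm_gammaRatio_add_nat_le {z : ℂ} (hz : 0 < z.re) (n : ℕ) :
    ‖gammaRatio (z + n)‖ ≤ ‖gammaRatio z‖ := by
  induction n with
  | zero => simp
  | succ n ih =>
    have hn : 0 < (z + n).re := by
      have : (0 : ℝ) ≤ n := n.cast_nonneg
      simp; linarith
    rw [show z + ((n + 1 : ℕ) : ℂ) = z + n + 1 by push_cast; ring, gammaRatio_add_one hn, norm_mul]
    refine (mul_le_of_le_one_right (norm_nonneg _) ?_).trans ih
    rw [norm_div]
    refine div_le_one_of_le₀ ?_ (norm_nonneg _)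
    rw [← sq_le_sq₀ (norm_nonneg _) (norm_nonneg _), ← normSq_eq_norm_sq, ← normSq_eq_norm_sq,
      normSq_apply, normSq_apply]
    generalize z + (n : ℂ) = u at hn
    simp
    nlinarith

/-- Because `z + (z + 1) = 2(z + 1/2)`, the powers of `n` and the factorials in Euler's products
cancel, leaving only the linear factors. -/
theorem GammaSeq_mul_div_sq {z : ℂ} (hz : 0 < z.re) {n : ℕ} (hn : n ≠ 0) :
    GammaSeq z n * GammaSeq (z + 1) n / GammaSeq (z + 1 / 2) n ^ 2 =
      ∏ j ∈ Finset.range (n + 1), (z + j + 1 / 2) ^ 2 / ((z + j) * (z + j + 1)) := by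
  have hn' : (n : ℂ) ≠ 0 := Nat.cast_ne_zero.mpr hn
  have e : (n : ℂ) ^ z * (n : ℂ) ^ (z + 1) = ((n : ℂ) ^ (z + 1 / 2)) ^ 2 := by
    rw [← cpow_add _ _ hn', sq, ← cpow_add _ _ hn']; ring_nf
  have p1 : (n : ℂ) ^ (z + 1 / 2) ≠ 0 := by simp [cpow_eq_zero_iff, hn']
  have p2 : (n ! : ℂ) ≠ 0 := Nat.cast_ne_zero.mpr (Nat.factorial_ne_zero n)
  have q : ∀ c : ℝ, 0 ≤ c → ∏ j ∈ Finset.range (n + 1), (z + c + j) ≠ 0 := fun c hc =>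
    Finset.prod_ne_zero_iff.mpr fun j _ h => by
      have := congrArg Complex.re h
      have h' : (0 : ℝ) ≤ j := j.cast_nonneg
      simp at this
      linarith
  have q0 := q 0 le_rfl
  have q1 := q 1 zero_le_one
  have q2 := q (1 / 2) (by norm_num)
  push_cast at q0 q1 q2
  simp only [add_zero] at q0
  rw [Finset.prod_div_distrib, Finset.prod_mul_distrib, Finset.prod_pow]
  simp only [GammaSeq]
  rw [show ∏ j ∈ Finset.range (n + 1), (z + j + 1 / 2) = ∏ j ∈ Finset.range (n + 1), (z + 1 / 2 + j)
    from Finset.prod_congr rfl fun j _ => by ring,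
    show ∏ j ∈ Finset.range (n + 1), (z + j + 1) = ∏ j ∈ Finset.range (n + 1), (z + 1 + j)
    from Finset.prod_congr rfl fun j _ => by ring]
  generalize ∏ j ∈ Finset.range (n + 1), (z + 1 / 2 + (j : ℂ)) = c₂ at *
  generalize (n : ℂ) ^ (z + 1 / 2) = c₃ at *
  field_simp
  rw [← e]

theorem tendsto_GammaSeq_mul_div_sq {z : ℂ} (hz : 0 < z.re) :
    Tendsto (fun n : ℕ => ∏ j ∈ Finset.range (n + 1), (z + j + 1 / 2) ^ 2 / ((z + j) * (z + j + 1)))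
      atTop (𝓝 (Gamma z * Gamma (z + 1) / Gamma (z + 1 / 2) ^ 2)) := by
  have h : Gamma (z + 1 / 2) ≠ 0 := Gamma_ne_zero_of_re_pos (by simp; linarith)
  refine (((GammaSeq_tendsto_Gamma z).mul (GammaSeq_tendsto_Gamma (z + 1))).div
    ((GammaSeq_tendsto_Gamma (z + 1 / 2)).pow 2) (pow_ne_zero 2 h)).congr' ?_
  filter_upwards [eventually_ne_atTop 0] with n hn using GammaSeq_mul_div_sq hz hn

/-- The quotient is `1 + 1 / (4z(z + 1))`, and both `|z|` and `|z + 1|` are bounded below by their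
values at the real point `x₀`. -/
theorem norm_sq_div_le {x₀ : ℝ} (hx : 0 < x₀) {z : ℂ} (hz : x₀ ≤ z.re) :
    ‖(z + 1 / 2) ^ 2 / (z * (z + 1))‖ ≤ (x₀ + 1 / 2) ^ 2 / (x₀ * (x₀ + 1)) := by
  have h1 : z ≠ 0 := fun h => by simp [h] at hz; linarith
  have h2 : z + 1 ≠ 0 := fun h => by
    have := congrArg Complex.re h
    simp at this; linarith
  have n1 : x₀ ≤ ‖z‖ := hz.trans (re_le_norm z)
  have n2 : x₀ + 1 ≤ ‖z + 1‖ := (by simpa using hz : x₀ + 1 ≤ (z + 1).re).trans (re_le_norm _)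
  rw [show (z + 1 / 2) ^ 2 / (z * (z + 1)) = 1 + 1 / (4 * (z * (z + 1))) by field_simp; ring,
    show (x₀ + 1 / 2) ^ 2 / (x₀ * (x₀ + 1)) = 1 + 1 / (4 * (x₀ * (x₀ + 1))) by field_simp; ring]
  refine (norm_add_le _ _).trans ?_
  simp only [norm_one, norm_div, norm_mul, Complex.norm_ofNat]
  gcongr

theorem norm_Gamma_mul_div_sq_le {x₀ : ℝ} (hx : 0 < x₀) {z : ℂ} (hz : x₀ ≤ z.re) :
    ‖Gamma z * Gamma (z + 1) / Gamma (z + 1 / 2) ^ 2‖ ≤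
      ‖Gamma x₀ * Gamma (x₀ + 1) / Gamma (x₀ + 1 / 2) ^ 2‖ := by
  refine le_of_tendsto_of_tendsto' (tendsto_GammaSeq_mul_div_sq (hx.trans_le hz)).norm
    (tendsto_GammaSeq_mul_div_sq (z := x₀) (by simpa using hx)).norm fun n => ?_
  rw [norm_prod, norm_prod]
  refine Finset.prod_le_prod (fun _ _ => norm_nonneg _) fun j _ => ?_
  have hj : (0 : ℝ) ≤ j := j.cast_nonneg
  have := norm_sq_div_le (x₀ := x₀ + j) (by positivity) (z := z + j) (by simpa using hz)
  refine this.trans (le_of_eq ?_)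
  rw [show ((x₀ : ℂ) + j + 1 / 2) ^ 2 / ((x₀ + j) * (x₀ + j + 1)) =
    (((x₀ + j + 1 / 2) ^ 2 / ((x₀ + j) * (x₀ + j + 1)) : ℝ) : ℂ) by push_cast; ring,
    Complex.norm_real, Real.norm_of_nonneg (by positivity)]

/-- `|Γ(z) / Γ(z + 1/2)|² ≪ 1 / |z|`, uniformly for `Re z` bounded below by a positive number. -/
theorem exists_norm_gammaRatio_le {x₀ : ℝ} (hx : 0 < x₀) :
    ∃ K : ℝ, 0 < K ∧ ∀ z : ℂ, x₀ ≤ z.re → ‖gammaRatio z‖ ≤ K * ‖z‖ ^ (-(1 / 2) : ℝ) := by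
  set K := ‖Gamma x₀ * Gamma (x₀ + 1) / Gamma (x₀ + 1 / 2) ^ 2‖
  refine ⟨√K + 1, by positivity, fun z hz => ?_⟩
  have h1 : z ≠ 0 := fun h => by simp [h] at hz; linarith
  have h2 : Gamma (z + 1 / 2) ≠ 0 := Gamma_ne_zero_of_re_pos (by simp; linarith)
  -- Writing `Γ(z) = Γ(z + 1) / z` in one factor of the square isolates the decay `1 / z` from a
  -- bounded quotient.
  have e : gammaRatio z ^ 2 = (Gamma z * Gamma (z + 1) / Gamma (z + 1 / 2) ^ 2) / z := by
    rw [gammaRatio, Gamma_add_one z h1]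
    field_simp
  have hle : ‖gammaRatio z‖ ^ 2 ≤ K / ‖z‖ := by
    rw [← norm_pow, e, norm_div]
    gcongr
    exact norm_Gamma_mul_div_sq_le hx hz
  have := Real.le_sqrt_of_sq_le hle
  rw [Real.sqrt_div (norm_nonneg _)] at this
  rw [Real.rpow_neg (norm_nonneg _), ← Real.sqrt_eq_rpow, ← div_eq_mul_inv]
  refine this.trans ?_
  gcongr
  linarith

theorem differentiableAt_gammaRatio {z : ℂ} (hz : 0 < z.re) :
    DifferentiableAt ℂ gammaRatio z := by
  have h : ∀ w : ℂ, 0 < w.re → DifferentiableAt ℂ Gamma w := fun w hw =>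
    differentiableAt_Gamma w fun m hm => by
      rw [hm] at hw
      have : (0 : ℝ) ≤ m := m.cast_nonneg
      simp at hw
      linarith
  have h2 : 0 < (z + 1 / 2).re := by simp; linarith
  exact (h z hz).div ((h _ h2).comp z (by fun_prop)) (Gamma_ne_zero_of_re_pos h2)

end GammaRatio

/-! ### Cauchy's formula on a half-plane with kernel `λ / (S² - λ²)`. -/

section Contour

open Complex Filter Topology MeasureTheory

theorem arg_eq_arctan_of_re_pos {w : ℂ} (hw : 0 < w.re) : w.arg = Real.arctan (w.im / w.re) := by
  have h : |w.arg| < Real.pi / 2 := abs_arg_lt_pi_div_two_iff.mpr (Or.inl hw)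
  rw [← tan_arg, Real.arctan_tan (abs_lt.mp h).1 (abs_lt.mp h).2]

theorem tendsto_arg_add_mul_I_atTop {w : ℂ} (hw : 0 < w.re) :
    Tendsto (fun t : ℝ => (w + t * I).arg) atTop (𝓝 (Real.pi / 2)) := by
  have e : (fun t : ℝ => (w + t * I).arg) = fun t : ℝ => Real.arctan ((w.im + t) / w.re) := by
    funext t
    rw [arg_eq_arctan_of_re_pos (by simpa using hw)]
    simp
  rw [e]
  exact (tendsto_nhds_of_tendsto_nhdsWithin Real.tendsto_arctan_atTop).comp
    ((tendsto_atTop_add_const_left _ _ tendsto_id).atTop_div_const hw)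

theorem tendsto_arg_add_mul_I_atBot {w : ℂ} (hw : 0 < w.re) :
    Tendsto (fun t : ℝ => (w + t * I).arg) atBot (𝓝 (-(Real.pi / 2))) := by
  have e : (fun t : ℝ => (w + t * I).arg) = fun t : ℝ => Real.arctan ((w.im + t) / w.re) := by
    funext t
    rw [arg_eq_arctan_of_re_pos (by simpa using hw)]
    simp
  rw [e]
  exact (tendsto_nhds_of_tendsto_nhdsWithin Real.tendsto_arctan_atBot).comp
    ((tendsto_atBot_add_const_left _ _ tendsto_id).atBot_div_const hw)

/-- A vertical line stays away from a point on its side, at a distance growing linearly. -/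
theorem one_add_abs_le_mul_norm_add_mul_I {w : ℂ} (hw : 0 < w.re) (t : ℝ) :
    1 + |t| ≤ ((1 + |w.im|) / w.re + 1) * ‖w + t * I‖ := by
  have h1 : w.re ≤ ‖w + t * I‖ := by simpa using re_le_norm (w + t * I)
  have h2 : |w.im + t| ≤ ‖w + t * I‖ := by simpa using abs_im_le_norm (w + t * I)
  have h3 : |t| ≤ |w.im + t| + |w.im| := by
    have := abs_sub (w.im + t) w.im
    simpa using this
  have h4 : 1 + |w.im| ≤ (1 + |w.im|) / w.re * ‖w + t * I‖ := by
    rw [div_mul_eq_mul_div, le_div_iff₀ hw]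
    gcongr
  linarith

theorem tendsto_norm_add_mul_I_cobounded (w : ℂ) :
    Tendsto (fun t : ℝ => ‖w + t * I‖) (Bornology.cobounded ℝ) atTop := by
  have h : Tendsto (fun t : ℝ => ‖t‖ - ‖w‖) (Bornology.cobounded ℝ) atTop :=
    tendsto_atTop_add_const_right _ _ tendsto_norm_cobounded_atTop
  refine tendsto_atTop_mono (fun t => ?_) h
  have := norm_sub_norm_le ((t : ℂ) * I) (-w)
  simp only [norm_mul, norm_I, mul_one, norm_real, norm_neg, sub_neg_eq_add] at this
  rwa [add_comm] at this

/-- With `λ = a + it`, `(S + λ) / (S - λ) = -1 + 2S / (S - λ)` tends to `-1`. -/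
theorem tendsto_log_norm_div (S : ℂ) (a : ℝ) :
    Tendsto (fun t : ℝ => Real.log (‖S + a + t * I‖ / ‖S - a - t * I‖)) (Bornology.cobounded ℝ)
      (𝓝 0) := by
  have hn : Tendsto (fun t : ℝ => ‖S - a - t * I‖) (Bornology.cobounded ℝ) atTop := by
    refine (tendsto_norm_add_mul_I_cobounded (-(S - a))).congr fun t => ?_
    rw [← norm_neg]
    ring_nf
  have h0 : Tendsto (fun t : ℝ => (S - a - t * I)⁻¹) (Bornology.cobounded ℝ) (𝓝 0) := by
    rw [tendsto_zero_iff_norm_tendsto_zero]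
    simp only [norm_inv]
    exact hn.inv_tendsto_atTop
  have h1 : Tendsto (fun t : ℝ => ‖-1 + 2 * S * (S - a - t * I)⁻¹‖) (Bornology.cobounded ℝ)
      (𝓝 1) := by
    simpa using ((h0.const_mul (2 * S)).const_add (-1)).norm
  have h2 : Tendsto (fun t : ℝ => ‖S + a + t * I‖ / ‖S - a - t * I‖) (Bornology.cobounded ℝ)
      (𝓝 1) := by
    refine h1.congr' ?_
    filter_upwards [hn.eventually_gt_atTop 0] with t ht
    rw [← norm_div]
    have : S - a - t * I ≠ 0 := norm_pos_iff.mp ht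
    congr 1
    field_simp
    ring
  simpa using h2.log one_ne_zero

/-- `log (S + λ) - log (S - λ)` on the line `Re λ = a`. -/
theorem clog_sub_clog_eq {S : ℂ} {a : ℝ} (h1 : 0 < (S + a).re) (h2 : 0 < (S - a).re) (t : ℝ) :
    log (S + a + t * I) - log (S - a - t * I) =
      (Real.log (‖S + a + t * I‖ / ‖S - a - t * I‖) : ℂ) +
        ((S + a + t * I).arg - (S - a + (-t : ℝ) * I).arg : ℝ) * I := by
  have n1 : S + a + t * I ≠ 0 := fun h => by
    have := congrArg Complex.re h; simp at this h1; linarith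
  have n2 : S - a - t * I ≠ 0 := fun h => by
    have := congrArg Complex.re h; simp at this h2; linarith
  rw [Real.log_div (norm_ne_zero_iff.mpr n1) (norm_ne_zero_iff.mpr n2), log, log,
    show S - a + (-t : ℝ) * I = S - a - t * I by push_cast; ring]
  push_cast
  ring

variable {S : ℂ} {a : ℝ}

theorem exists_norm_div_sq_sub_sq_le (ha : 0 < a) (hS : a < S.re) :
    ∃ B : ℝ, 0 < B ∧ ∀ t : ℝ, ‖S ^ 2 - (a + t * I) ^ 2‖⁻¹ ≤ B * (1 + |t|) ^ (-2 : ℝ) := by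
  have h1 : 0 < (S + a).re := by simp; linarith
  have h2 : 0 < (S - a).re := by simp; linarith
  refine ⟨((1 + |(S + a).im|) / (S + a).re + 1) * ((1 + |(S - a).im|) / (S - a).re + 1),
    by positivity, fun t => ?_⟩
  have b1 := one_add_abs_le_mul_norm_add_mul_I h1 t
  have b2 := one_add_abs_le_mul_norm_add_mul_I h2 (-t)
  have e : S ^ 2 - (a + t * I) ^ 2 = (S + a + t * I) * (S - a + (-t : ℝ) * I) := by push_cast; ring
  rw [abs_neg] at b2
  have p1 : 0 < ‖S + a + t * I‖ := norm_pos_iff.mpr fun h => by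
    have := congrArg Complex.re h; simp at this h1; linarith
  have p2 : 0 < ‖S - a + (-t : ℝ) * I‖ := norm_pos_iff.mpr fun h => by
    have := congrArg Complex.re h; simp at this h2; linarith
  rw [e, norm_mul, Real.rpow_neg (by positivity), ← div_eq_mul_inv, inv_eq_one_div,
    div_le_div_iff₀ (by positivity) (by positivity), one_mul, Real.rpow_two]
  calc (1 + |t|) ^ 2 = (1 + |t|) * (1 + |t|) := sq _
    _ ≤ _ := mul_le_mul b1 b2 (by positivity) (by positivity)
    _ = _ := by ring

theorem integrable_one_add_abs_rpow {r : ℝ} (hr : 1 < r) :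
    Integrable fun t : ℝ => (1 + |t|) ^ (-r) := by
  simpa using integrable_one_add_norm (E := ℝ) (μ := volume) (r := r) (by simpa using hr)

theorem sq_sub_sq_ne_zero (ha : 0 < a) (hS : a < S.re) (t : ℝ) : S ^ 2 - (a + t * I) ^ 2 ≠ 0 := by
  rw [sq_sub_sq]
  refine mul_ne_zero (fun h => ?_) (fun h => ?_) <;>
  · have := congrArg Complex.re h
    simp at this
    linarith

theorem integrable_div_sq_sub_sq (ha : 0 < a) (hS : a < S.re) :
    Integrable fun t : ℝ => S / (S ^ 2 - (a + t * I) ^ 2) := by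
  obtain ⟨B, hB, h⟩ := exists_norm_div_sq_sub_sq_le ha hS
  refine ((integrable_one_add_abs_rpow one_lt_two).const_mul (‖S‖ * B)).mono'
    (Continuous.aestronglyMeasurable ?_) (ae_of_all _ fun t => ?_)
  · exact continuous_const.div (by fun_prop) (sq_sub_sq_ne_zero ha hS)
  · rw [norm_div, div_eq_mul_inv, mul_assoc]
    gcongr
    exact h t

/-- An antiderivative is `(log(S + λ) - log(S - λ)) / (2i)`. The logarithms of the moduli cancel in
the limit, while the difference of arguments goes from `-π` to `π`. -/
theorem integral_div_sq_sub_sq (ha : 0 < a) (hS : a < S.re) :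
    ∫ t : ℝ, S / (S ^ 2 - (a + t * I) ^ 2) = Real.pi := by
  have h1 : 0 < (S + a).re := by simp; linarith
  have h2 : 0 < (S - a).re := by simp; linarith
  have hd : ∀ t : ℝ, HasDerivAt (fun t : ℝ => (log (S + a + t * I) - log (S - a - t * I)) / (2 * I))
      (S / (S ^ 2 - (a + t * I) ^ 2)) t := fun t => by
    have m1 : S + a + t * I ∈ slitPlane := Or.inl (by simpa using h1)
    have m2 : S - a - t * I ∈ slitPlane := Or.inl (by simpa using h2)
    have d0 : HasDerivAt (fun t : ℝ => (t : ℂ) * I) I t := by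
      simpa using (hasDerivAt_id (t : ℂ)).comp_ofReal.mul_const I
    have d1 := (d0.const_add (S + a)).clog_real m1
    have d2 := (d0.const_sub (S - a)).clog_real m2
    refine ((d1.sub d2).div_const (2 * I)).congr_deriv ?_
    have n1 := slitPlane_ne_zero m1
    have n2 := slitPlane_ne_zero m2
    have := I_ne_zero
    rw [show S ^ 2 - (a + t * I) ^ 2 = (S + a + t * I) * (S - a - t * I) by ring]
    generalize hx : S + a + t * I = x at *
    generalize hy : S - a - t * I = y at *
    rw [show S = (x + y) / 2 by rw [← hx, ← hy]; ring]
    field_simp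
    ring
  have le_top : (atTop : Filter ℝ) ≤ Bornology.cobounded ℝ := by
    rw [IsOrderBornology.cobounded_eq]
    exact le_sup_right
  have le_bot : (atBot : Filter ℝ) ≤ Bornology.cobounded ℝ := by
    rw [IsOrderBornology.cobounded_eq]
    exact le_sup_left
  have top := (tendsto_log_norm_div S a).mono_left le_top
  have bot := (tendsto_log_norm_div S a).mono_left le_bot
  have lim_top : Tendsto (fun t : ℝ => (log (S + a + t * I) - log (S - a - t * I)) / (2 * I)) atTop
      (𝓝 (((0 : ℝ) + (Real.pi / 2 - -(Real.pi / 2) : ℝ) * I) / (2 * I))) := by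
    simp_rw [clog_sub_clog_eq h1 h2]
    refine Tendsto.div_const (Tendsto.add ?_ (Tendsto.mul_const _ ?_)) _
    · exact (continuous_ofReal.tendsto _).comp top
    · refine (continuous_ofReal.tendsto _).comp ((tendsto_arg_add_mul_I_atTop h1).sub ?_)
      exact (tendsto_arg_add_mul_I_atBot h2).comp tendsto_neg_atTop_atBot
  have lim_bot : Tendsto (fun t : ℝ => (log (S + a + t * I) - log (S - a - t * I)) / (2 * I)) atBot
      (𝓝 (((0 : ℝ) + (-(Real.pi / 2) - (Real.pi / 2) : ℝ) * I) / (2 * I))) := by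
    simp_rw [clog_sub_clog_eq h1 h2]
    refine Tendsto.div_const (Tendsto.add ?_ (Tendsto.mul_const _ ?_)) _
    · exact (continuous_ofReal.tendsto _).comp bot
    · refine (continuous_ofReal.tendsto _).comp ((tendsto_arg_add_mul_I_atBot h1).sub ?_)
      exact (tendsto_arg_add_mul_I_atTop h2).comp tendsto_neg_atBot_atTop
  rw [integral_of_hasDerivAt_of_tendsto hd (integrable_div_sq_sub_sq ha hS) lim_bot lim_top]
  have := I_ne_zero
  push_cast
  field_simp
  ring

/-- A function holomorphic on a right half-plane and decaying faster than `1 / |λ|` has vanishing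
integrals along vertical lines. -/
theorem integral_vertical_eq_zero {G : ℂ → ℂ} {M R₀ r : ℝ} (hr : 1 < r) (hM : 0 ≤ M)
    (hG : DifferentiableOn ℂ G {w | a ≤ w.re})
    (hb : ∀ w : ℂ, a ≤ w.re → R₀ ≤ ‖w‖ → ‖G w‖ ≤ M * ‖w‖ ^ (-r))
    (ha : 0 < a) (hint : Integrable fun t : ℝ => G (a + t * I)) :
    ∫ t : ℝ, G (a + t * I) = 0 := by
  have lim := intervalIntegral_tendsto_integral hint tendsto_neg_atTop_atBot tendsto_id
  refine tendsto_nhds_unique lim ?_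
  -- The rectangle has corners `a - iR` and `a + R + iR`. Its three other sides have lengths `R`,
  -- `R`, `2R` and lie at distance at least `R` from the origin, whence the constant 4.
  have bound : ∀ᶠ R : ℝ in atTop,
      ‖∫ t in (-R)..R, G (a + t * I)‖ ≤ 4 * M * R ^ (-(r - 1)) := by
    filter_upwards [eventually_ge_atTop R₀, eventually_gt_atTop 0] with R hR₀ hR
    have rect := integral_boundary_rect_eq_zero_of_differentiableOn G (a + (-R : ℝ) * I)
      ((a + R : ℝ) + R * I) (hG.mono fun w hw => by
        have := hw.1
        simp [Set.uIcc_of_le (show a ≤ a + R by linarith)] at this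
        exact this.1)
    simp only [add_re, ofReal_re, mul_re, I_re, mul_zero, ofReal_im, I_im, mul_one, sub_self,
      add_zero, add_im, mul_im, zero_add, smul_eq_mul] at rect
    have est : ∀ w : ℂ, a ≤ w.re → R ≤ ‖w‖ → ‖G w‖ ≤ M * R ^ (-r) := fun w hw hRw =>
      (hb w hw (hR₀.trans hRw)).trans (by
        gcongr ?_ * ?_
        exact Real.rpow_le_rpow_of_nonpos hR hRw (by linarith))
    have e1 : ‖∫ x in a..(a + R), G (x + (-R : ℝ) * I)‖ ≤ M * R ^ (-r) * |a + R - a| :=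
      intervalIntegral.norm_integral_le_of_norm_le_const fun x hx => by
        rw [Set.uIoc_of_le (by linarith)] at hx
        refine est _ (by simpa using hx.1.le) ?_
        have := abs_im_le_norm ((x : ℂ) + (-R : ℝ) * I)
        simpa [abs_of_pos hR] using this
    have e2 : ‖∫ x in a..(a + R), G (x + R * I)‖ ≤ M * R ^ (-r) * |a + R - a| :=
      intervalIntegral.norm_integral_le_of_norm_le_const fun x hx => by
        rw [Set.uIoc_of_le (by linarith)] at hx
        refine est _ (by simpa using hx.1.le) ?_
        have := abs_im_le_norm ((x : ℂ) + R * I)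
        simpa [abs_of_pos hR] using this
    have e3 : ‖∫ y in (-R)..R, G ((a + R : ℝ) + y * I)‖ ≤ M * R ^ (-r) * |R - -R| :=
      intervalIntegral.norm_integral_le_of_norm_le_const fun y _ => by
        refine est _ (by simp; linarith) ?_
        have := re_le_norm (((a + R : ℝ) : ℂ) + y * I)
        simp only [add_re, ofReal_re, mul_re, I_re, mul_zero, ofReal_im, I_im, mul_one, sub_self,
          add_zero] at this
        linarith
    have key : I * ∫ y in (-R)..R, G (a + y * I) =
        (∫ x in a..(a + R), G (x + (-R : ℝ) * I)) - (∫ x in a..(a + R), G (x + R * I)) +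
          I * ∫ y in (-R)..R, G ((a + R : ℝ) + y * I) := by
      linear_combination -rect
    have hpow : R ^ (-r) * R = R ^ (-(r - 1)) := by
      rw [show -(r - 1) = -r + 1 by ring, Real.rpow_add_one hR.ne']
    calc ‖∫ t in (-R)..R, G (a + t * I)‖ = ‖I * ∫ y in (-R)..R, G (a + y * I)‖ := by simp
      _ ≤ M * R ^ (-r) * |a + R - a| + M * R ^ (-r) * |a + R - a| + M * R ^ (-r) * |R - -R| := by
        rw [key]
        refine (norm_add_le _ _).trans (add_le_add ((norm_sub_le _ _).trans (add_le_add e1 e2)) ?_)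
        simpa using e3
      _ = 4 * M * R ^ (-(r - 1)) := by
        rw [show a + R - a = R by ring, show R - -R = 2 * R by ring, abs_of_pos hR,
          abs_of_pos (by positivity), ← hpow]
        ring
  refine squeeze_zero_norm' bound ?_
  simpa using (tendsto_rpow_neg_atTop (y := r - 1) (by linarith)).const_mul (4 * M)

/-- The kernel decays like `1 / |λ|`, so an extra `|λ|^{-1/2}` is just enough for an integrable
majorant. -/
theorem exists_norm_kernel_le (ha : 0 < a) (hS : a < S.re) :
    ∃ B : ℝ, 0 < B ∧ ∀ t : ℝ, ‖(a + t * I) / (S ^ 2 - (a + t * I) ^ 2)‖ *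
      ‖(a + t * I : ℂ)‖ ^ (-(1 / 2) : ℝ) ≤ B * (1 + |t|) ^ (-(3 / 2) : ℝ) := by
  obtain ⟨B, hB, h⟩ := exists_norm_div_sq_sub_sq_le ha hS
  refine ⟨(1 + a) ^ (1 / 2 : ℝ) * B, by positivity, fun t => ?_⟩
  have p : 0 < ‖(a + t * I : ℂ)‖ := norm_pos_iff.mpr fun h => by
    have := congrArg Complex.re h; simp at this; linarith
  have p' : 0 < 1 + |t| := by positivity
  have le : ‖(a + t * I : ℂ)‖ ≤ (1 + a) * (1 + |t|) := by
    refine (norm_add_le _ _).trans ?_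
    simp only [norm_real, norm_mul, norm_I, mul_one, Real.norm_eq_abs, abs_of_pos ha]
    nlinarith [abs_nonneg t]
  calc _ = ‖(a + t * I : ℂ)‖ ^ (1 / 2 : ℝ) * ‖S ^ 2 - (a + t * I) ^ 2‖⁻¹ := by
        rw [norm_div, show (1 / 2 : ℝ) = 1 + -(1 / 2) by norm_num, Real.rpow_add p, Real.rpow_one]
        ring_nf
    _ ≤ ((1 + a) * (1 + |t|)) ^ (1 / 2 : ℝ) * (B * (1 + |t|) ^ (-2 : ℝ)) := by
        gcongr
        exact h t
    _ = _ := by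
        rw [Real.mul_rpow (by positivity) (by positivity),
          show (-(3 / 2) : ℝ) = 1 / 2 + -2 by norm_num, Real.rpow_add p']
        ring

variable {F : ℂ → ℂ} {M a₀ : ℝ}

theorem integrable_kernel_mul (ha : 0 < a) (hS : a < S.re)
    (hF : ContinuousOn F {w | a ≤ w.re})
    (hb : ∀ w : ℂ, a ≤ w.re → ‖F w‖ ≤ M * ‖w‖ ^ (-(1 / 2) : ℝ)) :
    Integrable fun t : ℝ => (a + t * I) / (S ^ 2 - (a + t * I) ^ 2) * F (a + t * I) := by
  obtain ⟨B, hB, h⟩ := exists_norm_kernel_le ha hS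
  refine ((integrable_one_add_abs_rpow (r := 3 / 2) (by norm_num)).const_mul (|M| * B)).mono'
    (Continuous.aestronglyMeasurable ?_) (ae_of_all _ fun t => ?_)
  · refine Continuous.mul ?_ ?_
    · exact Continuous.div (by fun_prop) (by fun_prop) (sq_sub_sq_ne_zero ha hS)
    · exact hF.comp_continuous (by fun_prop) fun t => by simp
  · rw [norm_mul]
    calc _ ≤ ‖(a + t * I) / (S ^ 2 - (a + t * I) ^ 2)‖ *
          (|M| * ‖(a + t * I : ℂ)‖ ^ (-(1 / 2) : ℝ)) := by
          gcongr
          refine (hb _ (by simp)).trans ?_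
          gcongr
          exact le_abs_self M
      _ = |M| * (‖(a + t * I) / (S ^ 2 - (a + t * I) ^ 2)‖ *
          ‖(a + t * I : ℂ)‖ ^ (-(1 / 2) : ℝ)) := by ring
      _ ≤ _ := by
          rw [mul_assoc]
          exact mul_le_mul_of_nonneg_left (h t) (abs_nonneg M)

/-- Cauchy's integral formula on a half-plane, with the kernel `λ / (S² - λ²)`. -/
theorem integral_kernel_mul (ha : 0 < a) (ha₀ : a₀ < a) (hS : a < S.re)
    (hF : DifferentiableOn ℂ F {w | a₀ < w.re})
    (hb : ∀ w : ℂ, a ≤ w.re → ‖F w‖ ≤ M * ‖w‖ ^ (-(1 / 2) : ℝ)) :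
    ∫ t : ℝ, (a + t * I) / (S ^ 2 - (a + t * I) ^ 2) * F (a + t * I) = Real.pi * F S := by
  have hsub : {w : ℂ | a ≤ w.re} ⊆ {w | a₀ < w.re} := fun w hw => ha₀.trans_le hw
  have int1 := integrable_kernel_mul ha hS (hF.continuousOn.mono hsub) hb
  have int2 := (integrable_div_sq_sub_sq ha hS).mul_const (F S)
  -- Subtracting the value at `S` cancels the pole of `1 / (S² - w²)` there. The subtracted part
  -- contributes `π F(S)` by the explicit integral, and the remainder integrates to zero.
  set N : ℂ → ℂ := fun w => w * F w - S * F S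
  have hN : DifferentiableOn ℂ N {w | a₀ < w.re} :=
    (differentiableOn_id.mul hF).sub_const _
  have hopen : {w : ℂ | a₀ < w.re} ∈ 𝓝 S :=
    (isOpen_lt continuous_const continuous_re).mem_nhds (ha₀.trans hS)
  -- This is `N w / (S² - w²)`, extended holomorphically across `w = S`.
  set G : ℂ → ℂ := fun w => -dslope N S w / (S + w)
  have hGd : DifferentiableOn ℂ G {w | a ≤ w.re} := by
    refine DifferentiableOn.div (((differentiableOn_dslope hopen).mpr hN).mono hsub).neg
      (by fun_prop) fun w hw h => ?_
    have := congrArg Complex.re h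
    have hw' : a ≤ w.re := hw
    simp at this
    linarith
  have hGe : ∀ w : ℂ, w ≠ S → G w = N w / (S ^ 2 - w ^ 2) := fun w hw => by
    have : w - S ≠ 0 := sub_ne_zero.mpr hw
    simp only [G, dslope_of_ne _ hw, slope_def_field]
    rw [show N S = 0 by simp [N], sub_zero, sq_sub_sq, ← div_neg, ← div_div, div_div, div_div,
      ← neg_sub S w]
    congr 1
    ring
  have hne : ∀ t : ℝ, (a + t * I : ℂ) ≠ S := fun t h => by
    have := congrArg Complex.re h
    simp at this
    linarith
  have hline : ∀ t : ℝ, G (a + t * I) = (a + t * I) / (S ^ 2 - (a + t * I) ^ 2) * F (a + t * I) -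
      S / (S ^ 2 - (a + t * I) ^ 2) * F S := fun t => by
    rw [hGe _ (hne t)]
    simp only [N]
    ring
  have hM : 0 ≤ M := by
    have h1 := (norm_nonneg _).trans (hb S hS.le)
    have h2 : 0 < ‖S‖ := norm_pos_iff.mpr fun h => by simp [h] at hS; linarith
    exact nonneg_of_mul_nonneg_left h1 (by positivity)
  -- The threshold `2‖S‖ + 1` gives `‖S‖² ≤ ‖w‖² / 4`, hence the factor `3/4` below, and also `‖w‖ ≥
  -- 1`.
  have hGb : ∀ w : ℂ, a ≤ w.re → 2 * ‖S‖ + 1 ≤ ‖w‖ →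
      ‖G w‖ ≤ (4 / 3 * (M + ‖S * F S‖)) * ‖w‖ ^ (-(3 / 2) : ℝ) := fun w hw hSw => by
    have hS0 := norm_nonneg S
    have hw1 : 1 ≤ ‖w‖ := by linarith
    have hw0 : 0 < ‖w‖ := by linarith
    have hwS : w ≠ S := fun h => by rw [h] at hSw; linarith
    have d : 3 / 4 * ‖w‖ ^ 2 ≤ ‖S ^ 2 - w ^ 2‖ := by
      have := norm_sub_norm_le (w ^ 2) (S ^ 2)
      rw [norm_sub_rev, norm_pow, norm_pow] at this
      nlinarith
    have n : ‖N w‖ ≤ (M + ‖S * F S‖) * ‖w‖ ^ (1 / 2 : ℝ) := by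
      refine (norm_sub_le _ _).trans ?_
      rw [add_mul]
      refine add_le_add ?_ (le_mul_of_one_le_right (norm_nonneg _)
        (Real.one_le_rpow hw1 (by norm_num)))
      rw [norm_mul, show (1 / 2 : ℝ) = 1 + -(1 / 2) by norm_num, Real.rpow_add hw0, Real.rpow_one]
      calc ‖w‖ * ‖F w‖ ≤ ‖w‖ * (M * ‖w‖ ^ (-(1 / 2) : ℝ)) := by gcongr; exact hb w hw
        _ = _ := by ring
    rw [hGe w hwS, norm_div]
    calc ‖N w‖ / ‖S ^ 2 - w ^ 2‖
        ≤ ((M + ‖S * F S‖) * ‖w‖ ^ (1 / 2 : ℝ)) / (3 / 4 * ‖w‖ ^ 2) := by gcongr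
      _ = _ := by
        rw [show (-(3 / 2) : ℝ) = 1 / 2 - 2 by norm_num, Real.rpow_sub hw0, Real.rpow_two]
        field_simp
  have zero := integral_vertical_eq_zero (r := 3 / 2) (by norm_num) (by positivity) hGd hGb ha
    ((int1.sub int2).congr (ae_of_all _ fun t => (hline t).symm))
  simp_rw [hline] at zero
  rw [integral_sub int1 int2, integral_mul_const, integral_div_sq_sub_sq ha hS] at zero
  exact sub_eq_zero.mp zero

end Contour

/-! ### Pochhammer identities behind the quadratic transformation. -/

section Pochhammer

open Complex Filter Topology Finset

theorem ascPochhammer_eval_add {R : Type*} [CommSemiring R] (a : R) (m n : ℕ) :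
    (ascPochhammer R (m + n)).eval a =
      (ascPochhammer R m).eval a * (ascPochhammer R n).eval (a + m) := by
  rw [← ascPochhammer_mul, Polynomial.eval_mul, Polynomial.eval_comp]
  simp

theorem ascPochhammer_eval_succ_left {R : Type*} [CommSemiring R] (a : R) (n : ℕ) :
    (ascPochhammer R (n + 1)).eval a = a * (ascPochhammer R n).eval (a + 1) := by
  rw [add_comm n 1, ascPochhammer_eval_add]
  simp

theorem ascPochhammer_eval_ne_zero {a : ℂ} (ha : 0 < a.re) (n : ℕ) :
    (ascPochhammer ℂ n).eval a ≠ 0 := by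
  rw [Ne, ascPochhammer_eval_eq_zero_iff]
  rintro ⟨k, -, hk⟩
  have := congrArg Complex.re hk
  have h : (0 : ℝ) ≤ k := k.cast_nonneg
  simp at this
  linarith

/-- The duplication formula for Pochhammer symbols. -/
theorem ascPochhammer_eval_two_mul (ν : ℂ) (k : ℕ) :
    (ascPochhammer ℂ (2 * k)).eval ν =
      4 ^ k * (ascPochhammer ℂ k).eval (ν / 2) * (ascPochhammer ℂ k).eval ((ν + 1) / 2) := by
  induction k with
  | zero => simp
  | succ k ih =>
    rw [show 2 * (k + 1) = 2 * k + 1 + 1 by ring, ascPochhammer_succ_eval, ascPochhammer_succ_eval,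
      ih, ascPochhammer_succ_eval, ascPochhammer_succ_eval]
    push_cast
    ring

/-- The Chu–Vandermonde identity. -/
theorem sum_antidiagonal_choose_mul_ascPochhammer {R : Type*} [CommRing R] (a c : R) (n : ℕ) :
    ∑ p ∈ antidiagonal n, n.choose p.1 • ((-1) ^ p.1 * (ascPochhammer R p.1).eval a *
      (ascPochhammer R p.2).eval (c + p.1)) = (ascPochhammer R n).eval (c - a) := by
  induction n generalizing c with
  | zero => simp
  | succ n ih =>
    -- Pascal's rule pairs the terms, and `(c+k)_{m+1} - (a+k)(c+k+1)_m = (c-a)(c+1+k)_m` reduces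
    -- each pair to the case `n` at `c + 1`.
    rw [sum_antidiagonal_choose_succ_nsmul (fun k m => (-1) ^ k * (ascPochhammer R k).eval a *
      (ascPochhammer R m).eval (c + k)), ← sum_add_distrib, ascPochhammer_eval_succ_left,
      show c - a + 1 = c + 1 - a by ring, ← ih, mul_sum]
    refine sum_congr rfl fun p hp => ?_
    have : n.choose p.2 = n.choose p.1 := by
      rw [← mem_antidiagonal.mp hp, Nat.choose_symm_add]
    rw [this, ← smul_add, mul_smul_comm]
    congr 1
    rw [ascPochhammer_eval_succ_left, ascPochhammer_succ_eval]
    push_cast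
    ring_nf

/-- The factors `1/2 - n, …, -1/2`, negated and reversed, are `1/2, …, n - 1/2`. -/
theorem ascPochhammer_eval_half_sub (n : ℕ) :
    (-1) ^ n * (ascPochhammer ℂ n).eval (1 / 2 - n : ℂ) = (ascPochhammer ℂ n).eval (1 / 2) := by
  rw [show (1 / 2 - n : ℂ) = -(n - 1 / 2) by ring, ascPochhammer_eval_neg_eq_descPochhammer,
    descPochhammer_eval_eq_ascPochhammer, ← mul_assoc, ← mul_pow]
  norm_num

theorem hasSum_ascPochhammer_mul_pow (a : ℂ) {x : ℂ} (hx : ‖x‖ < 1) :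
    HasSum (fun n : ℕ => (ascPochhammer ℂ n).eval a / n ! * x ^ n) (1 / (1 - x) ^ a) := by
  have h := (one_div_one_sub_cpow_hasFPowerSeriesOnBall_zero a).hasSum_sub (y := x)
    (by simpa [Metric.mem_eball, edist_zero_right, enorm_eq_nnnorm, ← NNReal.coe_lt_coe] using hx)
  refine h.congr_fun fun n => ?_
  have e : (n ! : ℂ) * Ring.choose (a + n - 1) n = (ascPochhammer ℂ n).eval a := by
    rw [← Ring.multichoose_eq, ← nsmul_eq_mul, Ring.factorial_nsmul_multichoose_eq_ascPochhammer,
      Polynomial.ascPochhammer_smeval_eq_eval]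
  have : (n ! : ℂ) ≠ 0 := Nat.cast_ne_zero.mpr n.factorial_ne_zero
  rw [FormalMultilinearSeries.ofScalars_apply_eq, sub_zero, smul_eq_mul, ← e]
  field_simp

theorem norm_ascPochhammer_eval_le (a : ℂ) (n : ℕ) :
    ‖(ascPochhammer ℂ n).eval a‖ ≤ (ascPochhammer ℝ n).eval ‖a‖ := by
  induction n with
  | zero => simp
  | succ n ih =>
    rw [ascPochhammer_succ_eval, ascPochhammer_succ_eval, norm_mul]
    have := norm_add_le a n
    simp only [Complex.norm_natCast] at this
    gcongr
    exact (norm_nonneg _).trans ih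

/-- The coefficients of the hypergeometric series in the Legendre function. -/
theorem b_div_factorial_mul_four_pow {ν : ℂ} (k : ℕ) :
    b k ν / k ! * 4 ^ k = (ascPochhammer ℂ (2 * k)).eval ν /
      ((ascPochhammer ℂ k).eval (ν + 1 / 2) * k !) := by
  rw [b, ascPochhammer_eval_two_mul]
  field_simp

/-- These are the coefficients of `zⁿ` on the two sides of the quadratic transformation. The
identity is Chu–Vandermonde at `a = ν + n`, `c = ν + 1/2`, after `(ν)_{2k} (ν+2k)_m = (ν)_{n+k} =
(ν)_n (ν+n)_k` with `k + m = n`. -/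
theorem sum_antidiagonal_quadratic {ν : ℂ} (hν : 0 < ν.re) (n : ℕ) :
    ∑ p ∈ antidiagonal n, b p.1 ν / p.1 ! * 4 ^ p.1 *
      ((-1) ^ p.2 * ((ascPochhammer ℂ p.2).eval (ν + 2 * p.1) / p.2 !)) =
    (ascPochhammer ℂ n).eval (1 / 2 : ℂ) / n ! *
      ((ascPochhammer ℂ n).eval ν / (ascPochhammer ℂ n).eval (ν + 1 / 2)) := by
  have hc : 0 < (ν + 1 / 2).re := by simp; linarith
  have cn : (ascPochhammer ℂ n).eval (ν + 1 / 2) ≠ 0 := ascPochhammer_eval_ne_zero hc n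
  have nf : (n ! : ℂ) ≠ 0 := Nat.cast_ne_zero.mpr n.factorial_ne_zero
  have cv := sum_antidiagonal_choose_mul_ascPochhammer (ν + n) (ν + 1 / 2) n
  rw [show ν + 1 / 2 - (ν + n) = 1 / 2 - (n : ℂ) by ring] at cv
  rw [← ascPochhammer_eval_half_sub, ← cv, mul_sum, sum_div, sum_mul]
  refine sum_congr rfl fun p hp => ?_
  obtain ⟨k, m⟩ := p
  simp only at *
  have hkm : k + m = n := mem_antidiagonal.mp hp
  have kf : (k ! : ℂ) ≠ 0 := Nat.cast_ne_zero.mpr k.factorial_ne_zero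
  have mf : (m ! : ℂ) ≠ 0 := Nat.cast_ne_zero.mpr m.factorial_ne_zero
  have ck : (ascPochhammer ℂ k).eval (ν + 1 / 2) ≠ 0 := ascPochhammer_eval_ne_zero hc k
  have ch : (n.choose k : ℂ) * (k ! * m !) = n ! := by
    rw [← Nat.choose_mul_factorial_mul_factorial (show k ≤ n by omega), show n - k = m by omega]
    push_cast
    ring
  have split : (ascPochhammer ℂ n).eval (ν + 1 / 2) =
      (ascPochhammer ℂ k).eval (ν + 1 / 2) * (ascPochhammer ℂ m).eval (ν + 1 / 2 + k) := by
    rw [← hkm, ascPochhammer_eval_add]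
  have shift : (ascPochhammer ℂ (2 * k)).eval ν * (ascPochhammer ℂ m).eval (ν + 2 * k) =
      (ascPochhammer ℂ n).eval ν * (ascPochhammer ℂ k).eval (ν + n) := by
    rw [← ascPochhammer_eval_add, show n + k = 2 * k + m by omega, ascPochhammer_eval_add]
    push_cast
    rfl
  have sign : ((-1 : ℂ)) ^ n * (-1) ^ k = (-1) ^ m := by
    rw [← hkm, pow_add, mul_right_comm, ← mul_pow]
    simp
  rw [b_div_factorial_mul_four_pow, nsmul_eq_mul]
  have cm : (ascPochhammer ℂ m).eval (ν + 1 / 2 + k) ≠ 0 := by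
    intro h
    rw [split, h, mul_zero] at cn
    exact cn rfl
  calc _ = (-1) ^ m * ((ascPochhammer ℂ (2 * k)).eval ν * (ascPochhammer ℂ m).eval (ν + 2 * k)) /
        ((ascPochhammer ℂ k).eval (ν + 1 / 2) * (k ! * m !)) := by
        field_simp
    _ = _ := by
        rw [shift, split, ← sign, ← ch]
        have : (n.choose k : ℂ) ≠ 0 := fun h => by
          rw [h, zero_mul] at ch
          exact nf ch.symm
        generalize (ascPochhammer ℂ m).eval (ν + 1 / 2 + k) = x at *
        generalize (ascPochhammer ℂ k).eval (ν + 1 / 2) = y at *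
        field_simp

end Pochhammer

/-! ### The quadratic transformation of ₂F₁. -/

section Quadratic

open Complex Filter Topology Finset

theorem hasSum_ascPochhammer_mul_pow_real (a : ℝ) {x : ℝ} (hx : |x| < 1) :
    HasSum (fun n : ℕ => (ascPochhammer ℝ n).eval a / n ! * x ^ n) (1 / (1 - x) ^ a) := by
  have h := (Real.one_div_one_sub_rpow_hasFPowerSeriesOnBall_zero a).hasSum_sub (y := x)
    (by simpa [Metric.mem_eball, edist_zero_right, enorm_eq_nnnorm, ← NNReal.coe_lt_coe] using hx)
  refine h.congr_fun fun n => ?_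
  have e : (n ! : ℝ) * Ring.choose (a + n - 1) n = (ascPochhammer ℝ n).eval a := by
    rw [← Ring.multichoose_eq, ← nsmul_eq_mul, Ring.factorial_nsmul_multichoose_eq_ascPochhammer,
      Polynomial.ascPochhammer_smeval_eq_eval]
  have : (n ! : ℝ) ≠ 0 := Nat.cast_ne_zero.mpr n.factorial_ne_zero
  rw [FormalMultilinearSeries.ofScalars_apply_eq, sub_zero, smul_eq_mul, ← e]
  field_simp

theorem ascPochhammer_eval_nonneg (n : ℕ) {x : ℝ} (hx : 0 ≤ x) :
    0 ≤ (ascPochhammer ℝ n).eval x := by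
  induction n with
  | zero => simp
  | succ n ih =>
    rw [ascPochhammer_succ_eval]
    positivity

theorem ascPochhammer_eval_mono (n : ℕ) {x y : ℝ} (hx : 0 ≤ x) (hxy : x ≤ y) :
    (ascPochhammer ℝ n).eval x ≤ (ascPochhammer ℝ n).eval y := by
  induction n with
  | zero => simp
  | succ n ih =>
    rw [ascPochhammer_succ_eval, ascPochhammer_succ_eval]
    have := ascPochhammer_eval_nonneg n (hx.trans hxy)
    gcongr

section Hypergeometric

variable {a b' c' : ℂ}

theorem radius_ordinaryHypergeometricSeries (ha : 0 < a.re) (hb : 0 < b'.re) (hc : 0 < c'.re) :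
    (ordinaryHypergeometricSeries ℂ a b' c').radius = 1 := by
  have key : ∀ w : ℂ, 0 < w.re → ∀ k : ℕ, (k : ℂ) ≠ -w := fun w hw k h => by
    have := congrArg Complex.re h
    have h' : (0 : ℝ) ≤ k := k.cast_nonneg
    simp at this
    linarith
  exact ordinaryHypergeometricSeries_radius_eq_one ℂ a b' c'
    fun k => ⟨key a ha k, key b' hb k, key c' hc k⟩

theorem mem_eball_radius (ha : 0 < a.re) (hb : 0 < b'.re) (hc : 0 < c'.re) {w : ℂ} (hw : ‖w‖ < 1) :
    w ∈ Metric.eball (0 : ℂ) (ordinaryHypergeometricSeries ℂ a b' c').radius := by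
  rw [radius_ordinaryHypergeometricSeries ha hb hc]
  simpa [Metric.mem_eball, edist_zero_right, enorm_eq_nnnorm, ← NNReal.coe_lt_coe] using hw

theorem hasSum_ordinaryHypergeometric (ha : 0 < a.re) (hb : 0 < b'.re) (hc : 0 < c'.re) {w : ℂ}
    (hw : ‖w‖ < 1) :
    HasSum (fun n => ordinaryHypergeometricCoefficient a b' c' n * w ^ n) (₂F₁ a b' c' w) := by
  refine (FormalMultilinearSeries.hasSum _ (mem_eball_radius ha hb hc hw)).congr_fun fun n => ?_
  rw [ordinaryHypergeometricSeries_apply_eq]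
  rfl

theorem summable_norm_ordinaryHypergeometric (ha : 0 < a.re) (hb : 0 < b'.re) (hc : 0 < c'.re)
    {w : ℂ} (hw : ‖w‖ < 1) :
    Summable fun n => ‖ordinaryHypergeometricCoefficient a b' c' n * w ^ n‖ := by
  have := FormalMultilinearSeries.summable_norm_apply _ (mem_eball_radius ha hb hc hw)
  simpa only [ordinaryHypergeometricSeries_apply_eq, smul_eq_mul] using this

theorem analyticAt_ordinaryHypergeometric (ha : 0 < a.re) (hb : 0 < b'.re) (hc : 0 < c'.re)
    {w : ℂ} (hw : ‖w‖ < 1) : AnalyticAt ℂ (₂F₁ a b' c' : ℂ → ℂ) w := by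
  have h := (ordinaryHypergeometricSeries ℂ a b' c').hasFPowerSeriesOnBall
    (by rw [radius_ordinaryHypergeometricSeries ha hb hc]; exact one_pos)
  exact h.analyticAt_of_mem (mem_eball_radius ha hb hc hw)

end Hypergeometric

variable {ν : ℂ}

theorem b_div_factorial_eq (ν : ℂ) (k : ℕ) :
    b k ν / k ! = ordinaryHypergeometricCoefficient ((ν + 1) / 2) (ν / 2) (ν + 1 / 2) k := by
  rw [b, ordinaryHypergeometricCoefficient]
  ring

theorem re_params (hν : 0 < ν.re) :
    0 < ((ν + 1) / 2).re ∧ 0 < (ν / 2).re ∧ 0 < (ν + 1 / 2).re := by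
  refine ⟨?_, ?_, ?_⟩ <;> simp <;> linarith

theorem hasSum_b_mul_pow (hν : 0 < ν.re) {w : ℂ} (hw : ‖w‖ < 1) :
    HasSum (fun k => b k ν / k ! * w ^ k) (₂F₁ ((ν + 1) / 2) (ν / 2) (ν + 1 / 2) w) := by
  obtain ⟨h1, h2, h3⟩ := re_params hν
  simp only [b_div_factorial_eq]
  exact hasSum_ordinaryHypergeometric h1 h2 h3 hw

theorem summable_norm_b_mul_pow (hν : 0 < ν.re) {r : ℝ} (hr : 0 ≤ r) (hr1 : r < 1) :
    Summable fun k => ‖b k ν / (k ! : ℂ)‖ * r ^ k := by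
  obtain ⟨h1, h2, h3⟩ := re_params hν
  have := summable_norm_ordinaryHypergeometric h1 h2 h3 (w := r)
    (by rwa [norm_real, Real.norm_of_nonneg hr])
  simpa only [b_div_factorial_eq, norm_mul, norm_pow, norm_real, Real.norm_of_nonneg hr] using this

/-- Expanding each `(1 + z)^{-(ν+2k)}` by the binomial series gives a double series, which is
regrouped by total degree in `z`. Absolute convergence of the double series is what requires `z` to
be small. -/
theorem quadratic_transformation_of_small (hν : 0 < ν.re) {z : ℝ} (hz : 0 < z) (hz' : z < 1 / 10) :
    1 / (1 + z : ℂ) ^ ν * ₂F₁ ((ν + 1) / 2) (ν / 2) (ν + 1 / 2) (4 * (z : ℂ) / (1 + z) ^ 2) =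
      ₂F₁ (1 / 2 : ℂ) ν (ν + 1 / 2) (z : ℂ) := by
  set f : ℕ × ℕ → ℂ := fun p => b p.1 ν / p.1 ! * 4 ^ p.1 *
      ((-1) ^ p.2 * ((ascPochhammer ℂ p.2).eval (ν + 2 * p.1) / p.2 !)) * (z : ℂ) ^ (p.1 + p.2)
    with hf
  have nz : (1 + z : ℂ) ≠ 0 := by
    have : (1 + z : ℝ) ≠ 0 := by positivity
    exact_mod_cast this
  have hr0 : 0 ≤ 4 * z / (1 - z) ^ 2 := by positivity
  have hr1 : 4 * z / (1 - z) ^ 2 < 1 := by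
    have : 0 < 1 - z := by linarith
    rw [div_lt_one (by positivity)]
    nlinarith
  have hw : ‖4 * (z : ℂ) / (1 + z) ^ 2‖ < 1 := by
    rw [show 4 * (z : ℂ) / (1 + z) ^ 2 = ((4 * z / (1 + z) ^ 2 : ℝ) : ℂ) by push_cast; ring,
      norm_real, Real.norm_of_nonneg (by positivity), div_lt_one (by positivity)]
    nlinarith [sq_nonneg z]
  -- Taking absolute values turns `1 + z` into `1 - z` in the row sums, so the majorant needs `4z /
  -- (1 - z)² < 1`; `z < 1/10` ensures this.
  set g : ℕ × ℕ → ℝ := fun p => ‖b p.1 ν / (p.1 ! : ℂ)‖ * (4 * z) ^ p.1 *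
      ((ascPochhammer ℝ p.2).eval (‖ν‖ + 2 * p.1) / p.2 ! * z ^ p.2)
  have g_row : ∀ k, HasSum (fun m => g (k, m))
      (‖b k ν / (k ! : ℂ)‖ * (4 * z) ^ k * (1 / (1 - z) ^ (‖ν‖ + 2 * k))) := fun k =>
    (hasSum_ascPochhammer_mul_pow_real (‖ν‖ + 2 * k) (x := z)
      (by rw [abs_of_pos hz]; linarith)).mul_left _
  have g_sum : Summable g := by
    rw [summable_prod_of_nonneg fun p => by
      have := ascPochhammer_eval_nonneg p.2 (show 0 ≤ ‖ν‖ + 2 * p.1 by positivity)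
      simp only [Pi.zero_apply, g]
      positivity]
    refine ⟨fun k => (g_row k).summable, ?_⟩
    simp_rw [(g_row _).tsum_eq]
    refine ((summable_norm_b_mul_pow hν hr0 hr1).mul_right (1 / (1 - z) ^ ‖ν‖)).congr fun k => ?_
    have : 0 < 1 - z := by linarith
    rw [Real.rpow_add this, Real.rpow_mul this.le, Real.rpow_natCast, Real.rpow_two, div_pow]
    field_simp
  have f_sum : Summable f := by
    refine g_sum.of_norm_bounded fun p => ?_
    have h1 := norm_ascPochhammer_eval_le (ν + 2 * p.1) p.2
    have h2 : ‖ν + 2 * p.1‖ ≤ ‖ν‖ + 2 * p.1 := by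
      refine (norm_add_le _ _).trans ?_
      simp
    have h3 : (ascPochhammer ℝ p.2).eval ‖ν + 2 * p.1‖ ≤
        (ascPochhammer ℝ p.2).eval (‖ν‖ + 2 * p.1) :=
      ascPochhammer_eval_mono p.2 (norm_nonneg _) h2
    simp only [f, g, norm_mul, norm_pow, norm_neg, norm_one, one_pow, one_mul, norm_real,
      Real.norm_of_nonneg hz.le, Complex.norm_ofNat, norm_div, Complex.norm_natCast]
    calc _ = ‖b p.1 ν‖ / p.1 ! * (4 * z) ^ p.1 *
        (‖(ascPochhammer ℂ p.2).eval (ν + 2 * p.1)‖ / p.2 ! * z ^ p.2) := by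
          rw [mul_pow, pow_add]; ring
      _ ≤ _ := by
          gcongr
          exact h1.trans h3
  have f_row : ∀ k, HasSum (fun m => f (k, m))
      (1 / (1 + z : ℂ) ^ ν * (b k ν / k ! * (4 * (z : ℂ) / (1 + z) ^ 2) ^ k)) := fun k => by
    have h := (hasSum_ascPochhammer_mul_pow (ν + 2 * k) (x := -(z : ℂ))
      (by rw [norm_neg, norm_real, Real.norm_of_nonneg hz.le]; linarith)).mul_left
      (b k ν / k ! * 4 ^ k * (z : ℂ) ^ k)
    have e : (1 + z : ℂ) ^ (ν + 2 * k) = (1 + z : ℂ) ^ ν * ((1 + z) ^ 2) ^ k := by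
      rw [cpow_add _ _ nz, ← pow_mul, ← cpow_natCast]
      push_cast
      rfl
    have v : b k ν / k ! * 4 ^ k * (z : ℂ) ^ k * (1 / (1 - -(z : ℂ)) ^ (ν + 2 * k)) =
        1 / (1 + z : ℂ) ^ ν * (b k ν / k ! * (4 * (z : ℂ) / (1 + z) ^ 2) ^ k) := by
      rw [sub_neg_eq_add, e, div_pow, mul_pow]
      ring
    rw [← v]
    refine h.congr_fun fun m => ?_
    simp only [f]
    rw [neg_pow, pow_add]
    ring
  have f_has : HasSum f (1 / (1 + z : ℂ) ^ ν *
      ₂F₁ ((ν + 1) / 2) (ν / 2) (ν + 1 / 2) (4 * (z : ℂ) / (1 + z) ^ 2)) := by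
    have h1 := f_sum.hasSum.prod_fiberwise f_row
    have h2 := (hasSum_b_mul_pow hν hw).mul_left (1 / (1 + z : ℂ) ^ ν)
    rw [← h1.unique h2]
    exact f_sum.hasSum
  have diag : HasSum (fun n => ∑ p ∈ antidiagonal n, f p) (1 / (1 + z : ℂ) ^ ν *
      ₂F₁ ((ν + 1) / 2) (ν / 2) (ν + 1 / 2) (4 * (z : ℂ) / (1 + z) ^ 2)) := by
    have h1 := HasAntidiagonal.sigmaAntidiagonalEquivProd.hasSum_iff.mpr f_has
    refine h1.sigma fun n => ?_
    exact (antidiagonal n).hasSum f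
  refine diag.unique ?_
  have h3 := (re_params hν).2.2
  have hz1 : ‖(z : ℂ)‖ < 1 := by rw [norm_real, Real.norm_of_nonneg hz.le]; linarith
  refine (hasSum_ordinaryHypergeometric (a := 1 / 2) (by norm_num) hν h3 hz1).congr_fun fun n => ?_
  have e : ∑ p ∈ antidiagonal n, f p = (∑ p ∈ antidiagonal n, b p.1 ν / p.1 ! * 4 ^ p.1 *
      ((-1) ^ p.2 * ((ascPochhammer ℂ p.2).eval (ν + 2 * p.1) / p.2 !))) * (z : ℂ) ^ n := by
    rw [sum_mul]
    refine sum_congr rfl fun p hp => ?_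
    rw [hf, ← mem_antidiagonal.mp hp]
  rw [e, sum_antidiagonal_quadratic hν, ordinaryHypergeometricCoefficient]
  ring

/-- A quadratic transformation of the hypergeometric function. -/
theorem quadratic_transformation (hν : 0 < ν.re) {z : ℝ} (hz : 0 < z) (hz' : z < 1) :
    1 / (1 + z : ℂ) ^ ν * ₂F₁ ((ν + 1) / 2) (ν / 2) (ν + 1 / 2) (4 * (z : ℂ) / (1 + z) ^ 2) =
      ₂F₁ (1 / 2 : ℂ) ν (ν + 1 / 2) (z : ℂ) := by
  obtain ⟨h1, h2, h3⟩ := re_params hν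
  have an : ∀ (f : ℂ → ℂ) (x : ℝ), AnalyticAt ℂ f x → AnalyticAt ℝ (fun t : ℝ => f t) x :=
    fun f x hf => hf.restrictScalars.comp (ofRealCLM.analyticAt x)
  have lhs : AnalyticOnNhd ℝ (fun t : ℝ => 1 / (1 + t : ℂ) ^ ν *
      ₂F₁ ((ν + 1) / 2) (ν / 2) (ν + 1 / 2) (4 * (t : ℂ) / (1 + t) ^ 2)) (Set.Ioo 0 1) := by
    intro x hx
    refine an (fun t : ℂ => 1 / (1 + t) ^ ν *
      ₂F₁ ((ν + 1) / 2) (ν / 2) (ν + 1 / 2) (4 * t / (1 + t) ^ 2)) x ?_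
    have sl : (1 + x : ℂ) ∈ slitPlane := Or.inl (by simp; linarith [hx.1])
    have nz : (1 + x : ℂ) ≠ 0 := slitPlane_ne_zero sl
    have hw : ‖4 * (x : ℂ) / (1 + x) ^ 2‖ < 1 := by
      have := hx.1
      rw [show 4 * (x : ℂ) / (1 + x) ^ 2 = ((4 * x / (1 + x) ^ 2 : ℝ) : ℂ) by push_cast; ring,
        norm_real, Real.norm_of_nonneg (by positivity), div_lt_one (by positivity)]
      nlinarith [mul_pos (sub_pos.mpr hx.2) (sub_pos.mpr hx.2)]
    refine AnalyticAt.mul (AnalyticAt.div analyticAt_const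
      ((analyticAt_const.add analyticAt_id).cpow analyticAt_const sl) ?_) ?_
    · simp [cpow_eq_zero_iff, nz]
    · exact AnalyticAt.comp (f := fun t : ℂ => 4 * t / (1 + t) ^ 2)
        (analyticAt_ordinaryHypergeometric h1 h2 h3 hw) ((analyticAt_const.mul analyticAt_id).div
          ((analyticAt_const.add analyticAt_id).pow 2) (pow_ne_zero 2 nz))
  have rhs : AnalyticOnNhd ℝ (fun t : ℝ => ₂F₁ (1 / 2 : ℂ) ν (ν + 1 / 2) (t : ℂ))
      (Set.Ioo 0 1) := fun x hx => an _ x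
    (analyticAt_ordinaryHypergeometric (by norm_num) hν h3
      (by rw [norm_real, Real.norm_of_nonneg hx.1.le]; exact hx.2))
  -- Both sides are real-analytic on `(0, 1)`; the point `1/20` is interior to the interval where
  -- the direct expansion applies.
  refine lhs.eqOn_of_preconnected_of_eventuallyEq rhs isPreconnected_Ioo (z₀ := 1 / 20)
    (by norm_num) ?_ ⟨hz, hz'⟩
  filter_upwards [Ioo_mem_nhds (show (0 : ℝ) < 1 / 20 by norm_num)
    (show (1 / 20 : ℝ) < 1 / 10 by norm_num)] with t ht
  exact quadratic_transformation_of_small hν ht.1 ht.2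

end Quadratic

/-! ### Expansion of the Legendre function in powers of `e^{-d}`. -/

section LegendreExpansion

open Complex Filter Topology

/-- The `n`-th term of the expansion of `Q_{ν-1}(cosh d)` in powers of `exp (-d)`. -/
noncomputable def legendreTerm (d : ℝ) (n : ℕ) (ν : ℂ) : ℂ :=
  (ascPochhammer ℂ n).eval (1 / 2 : ℂ) / n ! * ((√Real.pi : ℝ) : ℂ) * gammaRatio (ν + n) *
    exp (-d * (ν + 2 * n))

variable {ν : ℂ} {d : ℝ}

theorem ascPochhammer_eval_mul_gammaRatio (hν : 0 < ν.re) (n : ℕ) :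
    (ascPochhammer ℂ n).eval ν / (ascPochhammer ℂ n).eval (ν + 1 / 2) * gammaRatio ν =
      gammaRatio (ν + n) := by
  have key : ∀ w : ℂ, 0 < w.re → ∀ k : ℕ, w ≠ -k := fun w hw k h => by
    have h' : (0 : ℝ) ≤ k := k.cast_nonneg
    rw [h] at hw
    simp at hw
    linarith
  have h3 := (re_params hν).2.2
  have g1 := Gamma_ne_zero_of_re_pos hν
  have g2 := Gamma_ne_zero_of_re_pos h3
  have g3 : Gamma (ν + 1 / 2 + n) ≠ 0 := Gamma_ne_zero_of_re_pos (by
    have h' : (0 : ℝ) ≤ n := n.cast_nonneg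
    have : (ν + 1 / 2 + n).re = (ν + 1 / 2).re + n := by simp
    linarith)
  rw [← Gamma_add_nat_div_Gamma_eq ν (key ν hν), ← Gamma_add_nat_div_Gamma_eq _ (key _ h3),
    gammaRatio, gammaRatio, show ν + n + 1 / 2 = ν + 1 / 2 + n by ring]
  generalize Gamma (ν + 1 / 2) = x at *
  generalize Gamma (ν + 1 / 2 + n) = y at *
  field_simp

/-- With `z = e^{-2d}`, the argument of ₂F₁ in `legendreQ` is exactly the one in the quadratic
transformation. -/
theorem one_div_cosh_sq (d : ℝ) :
    1 / (Real.cosh d : ℂ) ^ 2 =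
      4 * ((Real.exp (-d) ^ 2 : ℝ) : ℂ) / (1 + ((Real.exp (-d) ^ 2 : ℝ) : ℂ)) ^ 2 := by
  have e : Real.exp d = (Real.exp (-d))⁻¹ := by rw [Real.exp_neg, inv_inv]
  have p := Real.exp_pos (-d)
  rw [Real.cosh_eq, e]
  generalize Real.exp (-d) = t at p
  norm_cast
  field_simp
  ring

theorem two_mul_cosh_cpow (d : ℝ) (ν : ℂ) :
    (2 * (Real.cosh d : ℂ)) ^ ν =
      exp (d * ν) * (1 + ((Real.exp (-d) ^ 2 : ℝ) : ℂ)) ^ ν := by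
  have e : (2 * (Real.cosh d : ℂ)) =
      (Real.exp d : ℂ) * ((1 + Real.exp (-d) ^ 2 : ℝ) : ℂ) := by
    rw [Real.cosh_eq, Real.exp_neg]
    norm_cast
    have := Real.exp_pos d
    field_simp
  rw [e, mul_cpow_ofReal_nonneg (Real.exp_pos d).le (by positivity),
    cpow_def_of_ne_zero (by exact_mod_cast (Real.exp_pos d).ne'), ← ofReal_log (Real.exp_pos d).le,
    Real.log_exp]
  push_cast
  rfl

/-- The expansion of the Legendre function `Q_{ν-1}(cosh d)` in powers of `exp (-d)`. -/
theorem hasSum_legendreTerm (hν : 0 < ν.re) (hd : 0 < d) :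
    HasSum (fun n => legendreTerm d n ν) (legendreQ (ν - 1) (Real.cosh d)) := by
  have ht : Real.exp (-d) ^ 2 < 1 := by
    rw [sq_lt_one_iff₀ (Real.exp_pos _).le, Real.exp_lt_one_iff]
    linarith
  have ht0 : 0 < Real.exp (-d) ^ 2 := by positivity
  have h3 := (re_params hν).2.2
  have Q : legendreQ (ν - 1) (Real.cosh d) = ((√Real.pi : ℝ) : ℂ) * gammaRatio ν * exp (-d * ν) *
      ₂F₁ (1 / 2 : ℂ) ν (ν + 1 / 2) ((Real.exp (-d) ^ 2 : ℝ) : ℂ) := by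
    rw [← quadratic_transformation hν ht0 ht, legendreQ, one_div_cosh_sq d,
      show ν - 1 + 1 = ν by ring, show ν - 1 + 3 / 2 = ν + 1 / 2 by ring,
      show ν - 1 + 2 = ν + 1 by ring, two_mul_cosh_cpow, gammaRatio, neg_mul, exp_neg]
    have := exp_ne_zero (d * ν)
    field_simp
  rw [Q]
  have h := (hasSum_ordinaryHypergeometric (a := 1 / 2) (by norm_num) hν h3
    (w := ((Real.exp (-d) ^ 2 : ℝ) : ℂ)) (by
      rwa [norm_real, Real.norm_of_nonneg ht0.le])).mul_left
    (((√Real.pi : ℝ) : ℂ) * gammaRatio ν * exp (-d * ν))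
  refine h.congr_fun fun n => ?_
  have e : exp (-d * (ν + 2 * n)) = exp (-d * ν) * ((Real.exp (-d) ^ 2 : ℝ) : ℂ) ^ n := by
    rw [← ofReal_pow, ← pow_mul, ← Real.exp_nat_mul, ofReal_exp, ← exp_add]
    push_cast
    ring_nf
  rw [legendreTerm, e, ← ascPochhammer_eval_mul_gammaRatio hν, ordinaryHypergeometricCoefficient]
  ring

/-- Compare `(1/2)ₙ` with `(1)ₙ = n!`. -/
theorem norm_ascPochhammer_half_div_factorial_le (n : ℕ) :
    ‖(ascPochhammer ℂ n).eval (1 / 2 : ℂ) / (n ! : ℂ)‖ ≤ 1 := by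
  rw [norm_div, Complex.norm_natCast, div_le_one₀ (by positivity)]
  have h := norm_ascPochhammer_eval_le (1 / 2) n
  have h2 : (ascPochhammer ℝ n).eval ‖(1 / 2 : ℂ)‖ ≤ (ascPochhammer ℝ n).eval 1 :=
    ascPochhammer_eval_mono n (norm_nonneg _) (by norm_num)
  rw [ascPochhammer_eval_one] at h2
  exact h.trans h2

theorem differentiableAt_legendreTerm (hν : 0 < ν.re) (d : ℝ) (n : ℕ) :
    DifferentiableAt ℂ (legendreTerm d n) ν := by
  have h : DifferentiableAt ℂ (fun ν : ℂ => gammaRatio (ν + n)) ν := by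
    refine DifferentiableAt.comp (g := gammaRatio) ν (differentiableAt_gammaRatio ?_) (by fun_prop)
    have : (0 : ℝ) ≤ n := n.cast_nonneg
    simp
    linarith
  unfold legendreTerm
  fun_prop

theorem exists_norm_legendreTerm_le {x₀ : ℝ} (hx : 0 < x₀) :
    ∃ K : ℝ, 0 < K ∧ ∀ (d : ℝ) (n : ℕ) (ν : ℂ), 0 ≤ d → x₀ ≤ ν.re →
      ‖legendreTerm d n ν‖ ≤
        K * ‖ν‖ ^ (-(1 / 2) : ℝ) * (Real.exp (-x₀ * d) * Real.exp (-2 * d) ^ n) := by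
  obtain ⟨K, hK, h⟩ := exists_norm_gammaRatio_le hx
  refine ⟨√Real.pi * K, by positivity, fun d n ν hd hν => ?_⟩
  have h1 := (norm_gammaRatio_add_nat_le (hx.trans_le hν) n).trans (h ν hν)
  have h2 : ‖exp (-d * (ν + 2 * n))‖ ≤ Real.exp (-x₀ * d) * Real.exp (-2 * d) ^ n := by
    rw [norm_exp, ← Real.exp_nat_mul, ← Real.exp_add, Real.exp_le_exp]
    have : (-d * (ν + 2 * n) : ℂ).re = -d * (ν.re + 2 * n) := by simp
    rw [this]
    nlinarith
  rw [legendreTerm, norm_mul, norm_mul, norm_mul, norm_real,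
    Real.norm_of_nonneg (Real.sqrt_nonneg _)]
  calc _ ≤ 1 * √Real.pi * (K * ‖ν‖ ^ (-(1 / 2) : ℝ)) *
        (Real.exp (-x₀ * d) * Real.exp (-2 * d) ^ n) := by
        gcongr
        exact norm_ascPochhammer_half_div_factorial_le n
    _ = _ := by ring

/-- The series of `𝒦_ν` for a single group element. -/
theorem hasSum_b_mul_cosh_cpow (hν : 1 / 2 < ν.re) (hd : 0 < d) :
    HasSum (fun k : ℕ => c ν * (b k ν / k ! * (Real.cosh d : ℂ) ^ (-(ν + 2 * k))))
      ((ν - 1 / 2) / (2 * Real.pi ^ 2 * I) * legendreQ (ν - 1) (Real.cosh d)) := by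
  have hν0 : 0 < ν.re := by linarith
  have hC : 1 < Real.cosh d := Real.one_lt_cosh.mpr hd.ne'
  have hC0 : 0 < Real.cosh d := by linarith
  have hCne : (Real.cosh d : ℂ) ≠ 0 := by exact_mod_cast hC0.ne'
  have hw : ‖1 / (Real.cosh d : ℂ) ^ 2‖ < 1 := by
    rw [norm_div, norm_one, norm_pow, norm_real, Real.norm_of_nonneg hC0.le,
      div_lt_one (by positivity)]
    nlinarith
  have h := (hasSum_b_mul_pow hν0 hw).mul_left (c ν * (Real.cosh d : ℂ) ^ (-ν))
  have v : c ν * (Real.cosh d : ℂ) ^ (-ν) *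
      ₂F₁ ((ν + 1) / 2) (ν / 2) (ν + 1 / 2) (1 / (Real.cosh d : ℂ) ^ 2) =
      (ν - 1 / 2) / (2 * Real.pi ^ 2 * I) * legendreQ (ν - 1) (Real.cosh d) := by
    have hh : (ν - 1 / 2) ≠ 0 := fun h => by
      have := congrArg Complex.re h
      simp at this
      linarith
    have g1 : Gamma (ν - 1 / 2) ≠ 0 := Gamma_ne_zero_of_re_pos (by simp; linarith)
    -- This is where the factor `ν - 1/2`, the numerator of the Cauchy kernel, comes from: `c ν`
    -- contains `Γ(ν - 1/2)` and the Legendre function `Γ(ν + 1/2)`.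
    have g2 : Gamma (ν + 1 / 2) = (ν - 1 / 2) * Gamma (ν - 1 / 2) := by
      rw [← Gamma_add_one _ hh]
      ring_nf
    have hpi : (Real.pi : ℂ) ≠ 0 := ofReal_ne_zero.mpr Real.pi_ne_zero
    have p1 : (Real.pi : ℂ) ^ (3 / 2 : ℂ) * ((√Real.pi : ℝ) : ℂ) = Real.pi ^ 2 := by
      rw [Real.sqrt_eq_rpow, ofReal_cpow Real.pi_pos.le, ← cpow_add _ _ hpi]
      norm_num
    have p2 : ((√Real.pi : ℝ) : ℂ) * ((√Real.pi : ℝ) : ℂ) = Real.pi := by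
      rw [← ofReal_mul, Real.mul_self_sqrt Real.pi_pos.le]
    have p3 : ((√Real.pi : ℝ) : ℂ) ≠ 0 := ofReal_ne_zero.mpr (by positivity)
    have p4 : (Real.pi : ℂ) ^ (3 / 2 : ℂ) = Real.pi * ((√Real.pi : ℝ) : ℂ) := by
      apply mul_right_cancel₀ p3
      rw [p1, mul_assoc, p2, sq]
    have q : (2 * (Real.cosh d : ℂ)) ^ ν = 2 ^ ν * (Real.cosh d : ℂ) ^ ν := by
      have := mul_cpow_ofReal_nonneg (zero_le_two (α := ℝ)) hC0.le ν
      exact_mod_cast this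
    have q2 : (2 : ℂ) ^ (-ν - 1) = (2 ^ ν)⁻¹ / 2 := by
      rw [cpow_sub _ _ two_ne_zero, cpow_neg, cpow_one]
    have n1 : (2 : ℂ) ^ ν ≠ 0 := by simp [cpow_eq_zero_iff]
    have n2 : (Real.cosh d : ℂ) ^ ν ≠ 0 := fun h => hCne (cpow_eq_zero_iff _ _ |>.mp h).1
    rw [c, legendreQ, show ν - 1 + 1 = ν by ring, show ν - 1 + 3 / 2 = ν + 1 / 2 by ring,
      show ν - 1 + 2 = ν + 1 by ring, q, q2, p4, g2, cpow_neg, ← p2]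
    have := I_ne_zero
    generalize Gamma (ν - 1 / 2) = x at *
    generalize hy : ν - 1 / 2 = y at *
    field_simp
  rw [← v]
  refine h.congr_fun fun k => ?_
  have e : (Real.cosh d : ℂ) ^ (-(ν + 2 * k)) =
      (Real.cosh d : ℂ) ^ (-ν) * (1 / (Real.cosh d : ℂ) ^ 2) ^ k := by
    rw [neg_add, cpow_add _ _ hCne, cpow_neg _ (2 * (k : ℂ)), one_div, inv_pow, ← pow_mul,
      ← cpow_natCast]
    push_cast
    rfl
  rw [e]
  ring

end LegendreExpansion

/-! ### Proper discontinuity of discrete subgroups of `PSL(2, ℝ)`. -/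

section Discrete

open Filter Topology MeasureTheory
open scoped Pointwise

instance isClosed_center_SL : IsClosed ((Subgroup.center SL(2, ℝ) : Subgroup SL(2, ℝ)) :
    Set SL(2, ℝ)) := by
  rw [Subgroup.coe_center, ← Set.centralizer_univ]
  exact Set.isClosed_centralizer _

/-- `SL(2, ℝ)` acts properly on `ℍ`, and the set in question is the image of its compact counterpart
there. -/
theorem isCompact_setOf_smul_mem (w : ℍ) {K : Set ℍ} (hK : IsCompact K) :
    IsCompact {p : PSL(2, ℝ) | p • w ∈ K} := by
  have h1 : IsCompact {g : SL(2, ℝ) | g • w ∈ K} := by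
    have := (ProperSMul.isProperMap_smul_pair (G := SL(2, ℝ)) (X := ℍ)).isCompact_preimage
      (hK.prod (isCompact_singleton (x := w)))
    convert this.image continuous_fst using 1
    ext g
    constructor
    · intro hg
      exact ⟨(g, w), ⟨hg, rfl⟩, rfl⟩
    · rintro ⟨⟨g', w'⟩, ⟨h, h'⟩, rfl⟩
      obtain rfl : w' = w := h'
      exact h
  convert h1.image (QuotientGroup.continuous_mk (N := Subgroup.center SL(2, ℝ))) using 1
  ext p
  induction p using QuotientGroup.induction_on with
  | H g =>
    constructor
    · intro hg
      exact ⟨g, hg, rfl⟩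
    · rintro ⟨g', hg', h⟩
      rw [← h]
      exact hg'

variable {Γ : Subgroup PSL(2, ℝ)}

theorem finite_setOf_dist_smul_le [DiscreteTopology Γ] (z w : ℍ) (R : ℝ) :
    {η : Γ | dist z (η • w) ≤ R}.Finite := by
  have hK := isCompact_setOf_smul_mem w (isCompact_closedBall z R)
  have h := (Subgroup.tendsto_coe_cofinite_of_discrete Γ ⟨‹_›⟩) hK.compl_mem_cocompact
  rw [mem_map, mem_cofinite] at h
  refine h.subset fun η hη => ?_
  simp only [Set.mem_compl_iff, Set.mem_preimage, not_not]
  change (η : PSL(2, ℝ)) • w ∈ Metric.closedBall z R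
  rw [Metric.mem_closedBall, dist_comm]
  exact hη

theorem dist_psl_smul (p : PSL(2, ℝ)) (z w : ℍ) : dist (p • z) (p • w) = dist z w := by
  induction p using QuotientGroup.induction_on with
  | H g => exact dist_smul g z w

theorem dist_smul_smul (η : Γ) (z w : ℍ) : dist (η • z) (η • w) = dist z w :=
  dist_psl_smul η z w

theorem volume_ball_smul (η : Γ) (w : ℍ) (r : ℝ) :
    volume (Metric.ball (η • w) r) = volume (Metric.ball w r) := by
  obtain ⟨p, hp⟩ := η
  change volume (Metric.ball (p • w) r) = _
  clear hp
  induction p using QuotientGroup.induction_on with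
  | H g =>
    have h : Metric.ball (g • w) r = g • Metric.ball w r := by
      exact (Metric.smul_ball g w r).symm
    rw [psl_mk_smul, h]
    exact measure_smul (volume : Measure ℍ) (Matrix.SpecialLinearGroup.toGL g) (Metric.ball w r)

/-- Only finitely many orbit elements bring `w` within distance 1 of `z`, and none of these
distances is zero. -/
theorem exists_forall_le_dist [DiscreteTopology Γ] {z w : ℍ} (h : ∀ η : Γ, z ≠ η • w) :
    ∃ d₀ : ℝ, 0 < d₀ ∧ ∀ η : Γ, d₀ ≤ dist z (η • w) := by
  have hfin := (finite_setOf_dist_smul_le (Γ := Γ) z w 1).image fun η => dist z (η • w)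
  obtain ⟨ε, hε, hb⟩ : ∃ ε > 0, Metric.ball (0 : ℝ) ε ⊆
      ((fun η : Γ => dist z (η • w)) '' {η : Γ | dist z (η • w) ≤ 1})ᶜ := by
    refine Metric.mem_nhds_iff.mp (hfin.isClosed.isOpen_compl.mem_nhds ?_)
    rintro ⟨η, -, hη⟩
    exact h η (dist_eq_zero.mp hη)
  refine ⟨min ε 1, by positivity, fun η => ?_⟩
  by_contra! hlt
  have h1 := hlt.trans_le (min_le_left _ _)
  have h2 := hlt.trans_le (min_le_right _ _)
  refine hb (a := dist z (η • w)) ?_ ⟨η, h2.le, rfl⟩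
  simpa [abs_of_nonneg] using h1

/-- Every point lies in a bounded number of the balls of radius `1` around an orbit. -/
theorem exists_card_filter_le [DiscreteTopology Γ] (w : ℍ) :
    ∃ N : ℕ, ∀ (s : Finset Γ) (v : ℍ), (s.filter fun η => dist (η • w) v < 1).card ≤ N := by
  classical
  set T := (finite_setOf_dist_smul_le (Γ := Γ) w w 2).toFinset
  refine ⟨T.card, fun s v => ?_⟩
  rcases (s.filter fun η => dist (η • w) v < 1).eq_empty_or_nonempty with h | ⟨η₀, h₀⟩
  · simp [h]
  · refine Finset.card_le_card_of_injOn (fun η => η₀⁻¹ * η) (fun η hη => ?_)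
      (fun _ _ _ _ h => mul_left_cancel h)
    have h1 := (Finset.mem_filter.mp h₀).2
    have h2 := (Finset.mem_filter.mp hη).2
    simp only [T, Set.Finite.coe_toFinset, Set.mem_ofPred_eq]
    rw [← dist_smul_smul η₀, mul_smul, smul_inv_smul]
    linarith [dist_triangle_right (η₀ • w) (η • w) v]

end Discrete

/-! ### Convergence of the Poincaré series for exponents above 1. -/

section PoincareSeries

open Filter Topology MeasureTheory
open scoped Pointwise

variable {σ : ℝ}

/-- A majorant of `y ^ (σ - 2) (1 + y ^ 2) ^ (1 - σ)` on the positive half-line. -/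
noncomputable def imMajorant (σ y : ℝ) : ℝ :=
  (Set.Ioc 0 1).indicator (fun y => y ^ (σ - 2)) y + (Set.Ioi 1).indicator (fun y => y ^ (-σ)) y

theorem integrable_imMajorant (hσ : 1 < σ) : Integrable (imMajorant σ) := by
  refine Integrable.add ?_ ?_
  · rw [integrable_indicator_iff measurableSet_Ioc,
      ← intervalIntegrable_iff_integrableOn_Ioc_of_le zero_le_one]
    exact intervalIntegral.intervalIntegrable_rpow' (by linarith)
  · rw [integrable_indicator_iff measurableSet_Ioi]
    exact integrableOn_Ioi_rpow_of_lt (by linarith) one_pos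

theorem le_imMajorant (hσ : 1 < σ) {y : ℝ} (hy : 0 < y) :
    y ^ (σ - 2) * (1 + y ^ 2) ^ (-(σ - 1)) ≤ imMajorant σ y := by
  rcases le_or_gt y 1 with h | h
  · have h1 : y ∈ Set.Ioc (0 : ℝ) 1 := ⟨hy, h⟩
    have h2 : y ∉ Set.Ioi (1 : ℝ) := by simpa using h
    rw [imMajorant, Set.indicator_of_mem h1, Set.indicator_of_notMem h2, add_zero]
    refine mul_le_of_le_one_right (by positivity) ?_
    exact Real.rpow_le_one_of_one_le_of_nonpos (by nlinarith [sq_nonneg y]) (by linarith)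
  · have h1 : y ∉ Set.Ioc (0 : ℝ) 1 := fun h' => absurd h'.2 (not_le.mpr h)
    have h2 : y ∈ Set.Ioi (1 : ℝ) := h
    rw [imMajorant, Set.indicator_of_notMem h1, Set.indicator_of_mem h2, zero_add]
    calc y ^ (σ - 2) * (1 + y ^ 2) ^ (-(σ - 1)) ≤ y ^ (σ - 2) * (y ^ 2) ^ (-(σ - 1)) := by
          gcongr ?_ * ?_
          exact Real.rpow_le_rpow_of_nonpos (by positivity) (by linarith) (by linarith)
      _ = y ^ (-σ) := by
          rw [← Real.rpow_two, ← Real.rpow_mul hy.le, ← Real.rpow_add hy]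
          ring_nf

/-- From `e^d ≥ cosh d = (1 + x² + y²) / (2y)`, split the exponent as `σ = 1 + (σ - 1)`: one power
of `1 + x² + y²` controls `x`, the other `σ - 1` control `y`. The bound is then a product of
functions of `x` and `y`. -/
theorem exp_neg_mul_dist_div_sq_le (hσ : 1 < σ) (v : ℍ) :
    Real.exp (-σ * dist UpperHalfPlane.I v) * (1 / v.im ^ 2) ≤
      2 ^ σ * (1 + v.re ^ 2)⁻¹ * imMajorant σ v.im := by
  have hy := v.im_pos
  set y := v.im
  set x := v.re
  set d := dist UpperHalfPlane.I v
  have hcosh : Real.cosh d = (1 + x ^ 2 + y ^ 2) / (2 * y) := by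
    rw [UpperHalfPlane.cosh_dist']
    simp [x, y]
    ring
  have hle : Real.cosh d ≤ Real.exp d := by
    rw [Real.cosh_eq]
    have hd : 0 ≤ d := dist_nonneg
    have : Real.exp (-d) ≤ Real.exp d := Real.exp_le_exp.mpr (by linarith)
    linarith
  have h1 : Real.exp (-σ * d) ≤ ((1 + x ^ 2 + y ^ 2) / (2 * y)) ^ (-σ) := by
    rw [show -σ * d = d * -σ by ring, Real.exp_mul, ← hcosh]
    exact Real.rpow_le_rpow_of_nonpos (Real.cosh_pos d) hle (by linarith)
  have h2 : ((1 + x ^ 2 + y ^ 2) / (2 * y)) ^ (-σ) =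
      2 ^ σ * y ^ σ * (1 + x ^ 2 + y ^ 2)⁻¹ * (1 + x ^ 2 + y ^ 2) ^ (-(σ - 1)) := by
    rw [Real.div_rpow (by positivity) (by positivity), Real.rpow_neg (by positivity : 0 ≤ 2 * y),
      Real.mul_rpow (by norm_num) hy.le, div_inv_eq_mul, ← Real.rpow_neg_one, mul_assoc _ (_ ^ _),
      ← Real.rpow_add (by positivity)]
    ring_nf
  have h3 : y ^ σ * (1 / y ^ 2) = y ^ (σ - 2) := by
    rw [Real.rpow_sub hy, Real.rpow_two]
    ring
  calc Real.exp (-σ * d) * (1 / y ^ 2)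
      ≤ 2 ^ σ * y ^ σ * (1 + x ^ 2 + y ^ 2)⁻¹ * (1 + x ^ 2 + y ^ 2) ^ (-(σ - 1)) * (1 / y ^ 2) := by
        rw [← h2]
        gcongr
    _ = 2 ^ σ * (1 + x ^ 2 + y ^ 2)⁻¹ * (y ^ (σ - 2) * (1 + x ^ 2 + y ^ 2) ^ (-(σ - 1))) := by
        rw [← h3]; ring
    _ ≤ 2 ^ σ * (1 + x ^ 2)⁻¹ * (y ^ (σ - 2) * (1 + y ^ 2) ^ (-(σ - 1))) := by
        have h4 : (1 + x ^ 2 + y ^ 2) ^ (-(σ - 1)) ≤ (1 + y ^ 2) ^ (-(σ - 1)) :=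
          Real.rpow_le_rpow_of_nonpos (by positivity) (by nlinarith [sq_nonneg x]) (by linarith)
        have h5 : (1 + x ^ 2 + y ^ 2)⁻¹ ≤ (1 + x ^ 2)⁻¹ :=
          inv_anti₀ (by positivity) (by nlinarith [sq_nonneg y])
        exact mul_le_mul (mul_le_mul_of_nonneg_left h5 (by positivity))
          (mul_le_mul_of_nonneg_left h4 (by positivity)) (by positivity) (by positivity)
    _ ≤ _ := by
        gcongr
        exact le_imMajorant hσ hy

theorem lintegral_exp_neg_mul_dist_lt_top (hσ : 1 < σ) :
    ∫⁻ v : ℍ, ENNReal.ofReal (Real.exp (-σ * dist UpperHalfPlane.I v)) < ⊤ := by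
  set h : ℝ × ℝ → ENNReal := fun p =>
    ENNReal.ofReal (2 ^ σ * (1 + p.1 ^ 2)⁻¹) * ENNReal.ofReal (imMajorant σ p.2)
  have int1 : Integrable fun x : ℝ => 2 ^ σ * (1 + x ^ 2)⁻¹ := integrable_inv_one_add_sq.const_mul _
  have int2 := integrable_imMajorant hσ
  have meas : Measurable (imMajorant σ) := by
    unfold imMajorant
    exact ((measurable_id.pow_const _).indicator measurableSet_Ioc).add
      ((measurable_id.pow_const _).indicator measurableSet_Ioi)
  have hm : Measurable h := by
    have m1 : Measurable fun p : ℝ × ℝ => ENNReal.ofReal (2 ^ σ * (1 + p.1 ^ 2)⁻¹) := by fun_prop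
    exact m1.mul (meas.comp measurable_snd).ennreal_ofReal
  have hdens : Measurable fun v : ℍ =>
      (((1 / NNReal.mk v.im v.im_pos.le : NNReal) ^ 2 : NNReal) : ENNReal) := by
    have : Continuous fun v : ℍ => (1 / NNReal.mk v.im v.im_pos.le : NNReal) ^ 2 := by
      refine .pow (.div₀ continuous_const ?_ ?_) _
      · exact UpperHalfPlane.continuous_im.subtype_mk _
      · exact fun x => NNReal.ne_iff.mp x.im_ne_zero
    exact this.measurable.coe_nnreal_ennreal
  have hexp : Measurable fun v : ℍ => ENNReal.ofReal (Real.exp (-σ * dist UpperHalfPlane.I v)) := by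
    have : Continuous fun v : ℍ => Real.exp (-σ * dist UpperHalfPlane.I v) := by fun_prop
    exact this.measurable.ennreal_ofReal
  rw [UpperHalfPlane.volume_def, lintegral_withDensity_eq_lintegral_mul _ hdens hexp]
  calc _ ≤ ∫⁻ v : ℍ, h (Complex.measurableEquivRealProd (v : ℂ))
          ∂(volume.comap UpperHalfPlane.coe) := by
        refine lintegral_mono fun v => ?_
        have e : (((1 / NNReal.mk v.im v.im_pos.le : NNReal) ^ 2 : NNReal) : ENNReal) =
            ENNReal.ofReal (1 / v.im ^ 2) := by
          rw [ENNReal.ofReal, ENNReal.coe_inj]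
          ext
          rw [Real.coe_toNNReal _ (by positivity)]
          simp
        simp only [Pi.mul_apply, h]
        rw [e, mul_comm, ← ENNReal.ofReal_mul (Real.exp_pos _).le,
          ← ENNReal.ofReal_mul (by positivity)]
        exact ENNReal.ofReal_le_ofReal (exp_neg_mul_dist_div_sq_le hσ v)
    _ = ∫⁻ z : ℂ in Set.range UpperHalfPlane.coe, h (Complex.measurableEquivRealProd z) := by
        rw [← UpperHalfPlane.measurableEmbedding_coe.map_comap,
          UpperHalfPlane.measurableEmbedding_coe.lintegral_map]
    _ ≤ ∫⁻ z : ℂ, h (Complex.measurableEquivRealProd z) := setLIntegral_le_lintegral _ _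
    _ = ∫⁻ p : ℝ × ℝ, h p := Complex.volume_preserving_equiv_real_prod.lintegral_comp hm
    _ = (∫⁻ x : ℝ, ENNReal.ofReal (2 ^ σ * (1 + x ^ 2)⁻¹)) *
          ∫⁻ y : ℝ, ENNReal.ofReal (imMajorant σ y) :=
        lintegral_prod_mul int1.aemeasurable.ennreal_ofReal int2.aemeasurable.ennreal_ofReal
    _ < ⊤ := ENNReal.mul_lt_top int1.lintegral_lt_top int2.lintegral_lt_top

theorem volume_ball_ne_zero (w : ℍ) {r : ℝ} (hr : 0 < r) : volume (Metric.ball w r) ≠ 0 := by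
  intro h
  have hpos : 0 < volume (UpperHalfPlane.coe '' Metric.ball w r) :=
    (UpperHalfPlane.isOpenEmbedding_coe.isOpenMap _ Metric.isOpen_ball).measure_pos _
      ((Metric.nonempty_ball.mpr hr).image _)
  rw [UpperHalfPlane.volume_eq_lintegral, lintegral_eq_zero_iff (by fun_prop)] at h
  have hm : MeasurableSet (UpperHalfPlane.coe '' Metric.ball w r) :=
    UpperHalfPlane.measurableEmbedding_coe.measurableSet_image.mpr measurableSet_ball
  rw [EventuallyEq, ae_restrict_iff' hm] at h
  refine hpos.ne' (measure_mono_null ?_ h)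
  rintro _ ⟨v, hv, rfl⟩
  have := v.im_ne_zero
  simpa [this] using hv

/-- The Poincaré series of a discrete group converges for exponents larger than one. -/
theorem summable_exp_neg_mul_dist {Γ : Subgroup PSL(2, ℝ)} [DiscreteTopology Γ] (hσ : 1 < σ)
    (z w : ℍ) : Summable fun η : Γ => Real.exp (-σ * dist z (η • w)) := by
  classical
  obtain ⟨N, hN⟩ := exists_card_filter_le (Γ := Γ) w
  -- The constant absorbs the base point: for `v` in the unit ball about `η • w`, `d(i, v) ≤ d(i, z)
  -- + d(z, ηw) + 1`, so `g v` dominates the term of `η`. The balls have equal volume and bounded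
  -- overlap, so the series is bounded by a multiple of `∫ g`.
  set g : ℍ → ENNReal := fun v => ENNReal.ofReal (Real.exp (σ * (dist UpperHalfPlane.I z + 1))) *
    ENNReal.ofReal (Real.exp (-σ * dist UpperHalfPlane.I v))
  have gm : Measurable g := by
    have : Continuous fun v : ℍ => Real.exp (-σ * dist UpperHalfPlane.I v) := by fun_prop
    exact this.measurable.ennreal_ofReal.const_mul _
  have gint : ∫⁻ v, g v < ⊤ := by
    rw [lintegral_const_mul' _ _ ENNReal.ofReal_ne_top]
    exact ENNReal.mul_lt_top ENNReal.ofReal_lt_top (lintegral_exp_neg_mul_dist_lt_top hσ)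
  set V := volume (Metric.ball w 1)
  have hV : V ≠ 0 := volume_ball_ne_zero w one_pos
  have hV' : V ≠ ⊤ := (measure_ball_lt_top (μ := (volume : Measure ℍ))).ne
  have term : ∀ η : Γ, ENNReal.ofReal (Real.exp (-σ * dist z (η • w))) * V ≤
      ∫⁻ v, (Metric.ball (η • w) 1).indicator g v := fun η => by
    have hη : volume (Metric.ball (η • w) 1) = V := volume_ball_smul η w 1
    rw [lintegral_indicator measurableSet_ball, ← hη, ← setLIntegral_const]
    refine setLIntegral_mono gm fun v hv => ?_
    simp only [g]
    rw [← ENNReal.ofReal_mul (Real.exp_pos _).le, ← Real.exp_add]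
    refine ENNReal.ofReal_le_ofReal (Real.exp_le_exp.mpr ?_)
    have h1 := dist_triangle4 UpperHalfPlane.I z (η • w) v
    have h2 : dist (η • w) v < 1 := by rwa [dist_comm, ← Metric.mem_ball]
    nlinarith
  have bound : ∀ s : Finset Γ, (∑ η ∈ s, ENNReal.ofReal (Real.exp (-σ * dist z (η • w)))) * V ≤
      N * ∫⁻ v, g v := fun s => by
    rw [Finset.sum_mul]
    calc _ ≤ ∑ η ∈ s, ∫⁻ v, (Metric.ball (η • w) 1).indicator g v :=
          Finset.sum_le_sum fun η _ => term η
      _ = ∫⁻ v, ∑ η ∈ s, (Metric.ball (η • w) 1).indicator g v :=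
          (lintegral_finsetSum _ fun η _ => gm.indicator measurableSet_ball).symm
      _ ≤ ∫⁻ v, N * g v := by
          refine lintegral_mono fun v => ?_
          have e : ∑ η ∈ s, (Metric.ball (η • w) 1).indicator g v =
              (s.filter fun η => dist (η • w) v < 1).card • g v := by
            rw [← Finset.sum_const, Finset.sum_filter]
            refine Finset.sum_congr rfl fun η _ => ?_
            simp only [Set.indicator_apply, Metric.mem_ball, dist_comm v]
          rw [e, nsmul_eq_mul]
          gcongr
          exact hN s v
      _ = N * ∫⁻ v, g v := lintegral_const_mul' _ _ (ENNReal.natCast_ne_top N)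
  have total : ∑' η : Γ, ENNReal.ofReal (Real.exp (-σ * dist z (η • w))) ≠ ⊤ := by
    refine ne_top_of_le_ne_top (b := (N * ∫⁻ v, g v) / V)
      (ENNReal.div_lt_top (ENNReal.mul_lt_top (ENNReal.natCast_lt_top N) gint).ne hV).ne ?_
    rw [ENNReal.tsum_eq_iSup_sum]
    exact iSup_le fun s => (ENNReal.le_div_iff_mul_le (Or.inl hV) (Or.inl hV')).mpr (bound s)
  refine (ENNReal.summable_toReal total).congr fun η => ?_
  rw [ENNReal.toReal_ofReal (Real.exp_pos _).le]

end PoincareSeries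

/-! ### Interchanging the sums over `Γ` and `ℕ` with each other and with the integral. -/

section Assembly

open Complex Filter Topology MeasureTheory

section Series

variable {ι : Type*} {d : ι → ℝ} {d₀ : ℝ} {ν : ℂ}

/-- Only the factor `cosh^{-2k}` is bounded through `d₀`. The majorant thereby splits into a
Poincaré-series term in `x` and a geometric term in `k`. -/
theorem norm_cosh_cpow_le {x : ℝ} (hd₀ : 0 ≤ d₀) (hx : d₀ ≤ x) (hν : 0 ≤ ν.re) (k : ℕ) :
    ‖(Real.cosh x : ℂ) ^ (-(ν + 2 * k))‖ ≤
      2 ^ ν.re * Real.exp (-ν.re * x) * ((Real.cosh d₀ ^ 2)⁻¹) ^ k := by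
  have hc := Real.cosh_pos x
  have hc₀ := Real.cosh_pos d₀
  have hle : Real.cosh d₀ ≤ Real.cosh x := by
    rw [Real.cosh_le_cosh, abs_of_nonneg hd₀]
    exact hx.trans (le_abs_self x)
  have hexp : Real.exp x / 2 ≤ Real.cosh x := by
    rw [Real.cosh_eq]
    linarith [Real.exp_pos (-x)]
  have e : (-(ν + 2 * k)).re = -ν.re + (-2 : ℝ) * k := by
    simp
    ring
  rw [norm_cpow_eq_rpow_re_of_pos hc, e, Real.rpow_add hc, Real.rpow_mul hc.le, Real.rpow_natCast]
  have h1 : Real.cosh x ^ (-ν.re) ≤ 2 ^ ν.re * Real.exp (-ν.re * x) := by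
    refine (Real.rpow_le_rpow_of_nonpos (by positivity) hexp (by linarith)).trans (le_of_eq ?_)
    rw [Real.div_rpow (Real.exp_pos _).le zero_le_two, ← Real.exp_mul,
      Real.rpow_neg zero_le_two, div_inv_eq_mul, mul_comm]
    ring_nf
  have h2 : Real.cosh x ^ (-2 : ℝ) ≤ (Real.cosh d₀ ^ 2)⁻¹ := by
    rw [Real.rpow_neg hc.le, Real.rpow_two]
    gcongr
  gcongr

theorem summable_b_mul_cosh_cpow (hd₀ : 0 < d₀) (hd : ∀ i, d₀ ≤ d i) (hν : 0 < ν.re)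
    (hs : Summable fun i => Real.exp (-ν.re * d i)) :
    Summable fun p : ι × ℕ =>
      b p.2 ν / (p.2 ! : ℂ) * (Real.cosh (d p.1) : ℂ) ^ (-(ν + 2 * p.2)) := by
  have hC : 1 < Real.cosh d₀ := Real.one_lt_cosh.mpr hd₀.ne'
  have hr : (Real.cosh d₀ ^ 2)⁻¹ < 1 := inv_lt_one_of_one_lt₀ (by nlinarith)
  have h := (hs.mul_left (2 ^ ν.re)).mul_of_nonneg
    (summable_norm_b_mul_pow hν (by positivity) hr) (fun _ => by positivity) (fun _ => by positivity)
  refine h.of_norm_bounded fun p => ?_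
  rw [norm_mul]
  calc _ ≤ ‖b p.2 ν / (p.2 ! : ℂ)‖ *
        (2 ^ ν.re * Real.exp (-ν.re * d p.1) * ((Real.cosh d₀ ^ 2)⁻¹) ^ p.2) := by
        gcongr
        exact norm_cosh_cpow_le hd₀.le (hd p.1) hν.le p.2
    _ = _ := by ring

theorem summable_cosh_cpow (hd₀ : 0 < d₀) (hd : ∀ i, d₀ ≤ d i) (hν : 0 < ν.re)
    (hs : Summable fun i => Real.exp (-ν.re * d i)) (k : ℕ) :
    Summable fun i => (Real.cosh (d i) : ℂ) ^ (-(ν + 2 * k)) :=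
  ((hs.mul_left (2 ^ ν.re)).mul_right _).of_norm_bounded fun i =>
    norm_cosh_cpow_le hd₀.le (hd i) hν.le k

theorem summable_exp_mul_exp_pow (hd₀ : 0 < d₀) {σ : ℝ}
    (hs : Summable fun i => Real.exp (-σ * d i)) :
    Summable fun p : ι × ℕ => Real.exp (-σ * d p.1) * Real.exp (-2 * d₀) ^ p.2 :=
  hs.mul_of_nonneg (summable_geometric_of_lt_one (Real.exp_pos _).le
    (Real.exp_lt_one_iff.mpr (by linarith))) (fun _ => (Real.exp_pos _).le) (fun _ => by positivity)

theorem exists_norm_legendreTerm_le_of_le (hd₀ : 0 < d₀) {σ : ℝ} (hσ : 0 < σ) :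
    ∃ K : ℝ, 0 < K ∧ ∀ (x : ℝ) (n : ℕ) (ν : ℂ), d₀ ≤ x → σ ≤ ν.re →
      ‖legendreTerm x n ν‖ ≤
        K * (Real.exp (-σ * x) * Real.exp (-2 * d₀) ^ n) * ‖ν‖ ^ (-(1 / 2) : ℝ) := by
  obtain ⟨K, hK, h⟩ := exists_norm_legendreTerm_le hσ
  refine ⟨K, hK, fun x n ν hx hν => (h x n ν (hd₀.le.trans hx) hν).trans ?_⟩
  rw [mul_right_comm]
  have h2 : Real.exp (-2 * x) ≤ Real.exp (-2 * d₀) := Real.exp_le_exp.mpr (by linarith)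
  gcongr

theorem summable_legendreTerm (hd₀ : 0 < d₀) (hd : ∀ i, d₀ ≤ d i) (hν : 0 < ν.re)
    (hs : Summable fun i => Real.exp (-ν.re * d i)) :
    Summable fun p : ι × ℕ => legendreTerm (d p.1) p.2 ν := by
  obtain ⟨K, -, h⟩ := exists_norm_legendreTerm_le_of_le hd₀ hν
  exact (((summable_exp_mul_exp_pow hd₀ hs).mul_left K).mul_right
    (‖ν‖ ^ (-(1 / 2) : ℝ))).of_norm_bounded fun p => h _ _ _ (hd p.1) le_rfl

theorem hasSum_legendreQ (hd₀ : 0 < d₀) (hd : ∀ i, d₀ ≤ d i) (hν : 0 < ν.re)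
    (hs : Summable fun i => Real.exp (-ν.re * d i)) :
    HasSum (fun i => legendreQ (ν - 1) (Real.cosh (d i)))
      (∑' p : ι × ℕ, legendreTerm (d p.1) p.2 ν) := by
  have h := (summable_legendreTerm hd₀ hd hν hs).hasSum
  have h2 : ∀ i, HasSum (fun n => legendreTerm (d i) n ν) (legendreQ (ν - 1) (Real.cosh (d i))) :=
    fun i => hasSum_legendreTerm hν (hd₀.trans_le (hd i))
  exact h.prod_fiberwise h2

/-- The double series over `ι × ℕ` converges absolutely. Summing `k` first gives Legendre functions;
summing `i` first gives the kernels. -/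
theorem hasSum_b_mul_tsum_cosh_cpow (hd₀ : 0 < d₀) (hd : ∀ i, d₀ ≤ d i) (hν : 1 / 2 < ν.re)
    (hs : Summable fun i => Real.exp (-ν.re * d i)) :
    HasSum (fun k : ℕ => c ν * (b k ν / (k ! : ℂ) * ∑' i, (Real.cosh (d i) : ℂ) ^ (-(ν + 2 * k))))
      ((ν - 1 / 2) / (2 * Real.pi ^ 2 * I) * ∑' p : ι × ℕ, legendreTerm (d p.1) p.2 ν) := by
  have hν0 : 0 < ν.re := by linarith
  have h := (summable_b_mul_cosh_cpow hd₀ hd hν0 hs).mul_left (c ν)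
  have h0 : ∀ i, HasSum (fun k : ℕ => c ν * (b k ν / (k ! : ℂ) *
      (Real.cosh (d i) : ℂ) ^ (-(ν + 2 * k))))
      ((ν - 1 / 2) / (2 * Real.pi ^ 2 * I) * legendreQ (ν - 1) (Real.cosh (d i))) :=
    fun i => hasSum_b_mul_cosh_cpow hν (hd₀.trans_le (hd i))
  have h1 := h.hasSum.prod_fiberwise h0
  have h2 := (hasSum_legendreQ hd₀ hd hν0 hs).mul_left ((ν - 1 / 2) / (2 * Real.pi ^ 2 * I))
  rw [← h1.unique h2]
  have h3 : ∀ k : ℕ, HasSum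
      (fun i => c ν * (b k ν / (k ! : ℂ) * (Real.cosh (d i) : ℂ) ^ (-(ν + 2 * k))))
      (c ν * (b k ν / (k ! : ℂ) * ∑' i, (Real.cosh (d i) : ℂ) ^ (-(ν + 2 * k)))) := fun k =>
    ((summable_cosh_cpow hd₀ hd hν0 hs k).hasSum.mul_left _).mul_left _
  have h4 := (Equiv.prodComm ℕ ι).hasSum_iff.mpr h.hasSum
  exact h4.prod_fiberwise h3

theorem summable_b_mul_tsum_cosh_cpow (hd₀ : 0 < d₀) (hd : ∀ i, d₀ ≤ d i) (hν : 0 < ν.re)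
    (hs : Summable fun i => Real.exp (-ν.re * d i)) :
    Summable fun k : ℕ => b k ν / (k ! : ℂ) * ∑' i, (Real.cosh (d i) : ℂ) ^ (-(ν + 2 * k)) := by
  have h := summable_b_mul_cosh_cpow hd₀ hd hν hs
  have h3 : ∀ k : ℕ, HasSum
      (fun i => b k ν / (k ! : ℂ) * (Real.cosh (d i) : ℂ) ^ (-(ν + 2 * k)))
      (b k ν / (k ! : ℂ) * ∑' i, (Real.cosh (d i) : ℂ) ^ (-(ν + 2 * k))) := fun k =>
    (summable_cosh_cpow hd₀ hd hν hs k).hasSum.mul_left _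
  have h4 := (Equiv.prodComm ℕ ι).hasSum_iff.mpr h.hasSum
  exact (h4.prod_fiberwise h3).summable

/-- The contour integral of the series of the Legendre functions `Q_{ν-1}`. -/
theorem integral_kernel_mul_tsum_legendreTerm (hd₀ : 0 < d₀) (hd : ∀ i, d₀ ≤ d i) {a : ℝ}
    (ha : 0 < a) (hs : Summable fun i => Real.exp (-(a + 1 / 2) * d i)) {S : ℂ} (hS : a < S.re) :
    Integrable (fun t : ℝ => (a + t * I) / (S ^ 2 - (a + t * I) ^ 2) *
      ∑' p : ι × ℕ, legendreTerm (d p.1) p.2 (a + t * I + 1 / 2)) ∧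
    ∫ t : ℝ, (a + t * I) / (S ^ 2 - (a + t * I) ^ 2) *
      ∑' p : ι × ℕ, legendreTerm (d p.1) p.2 (a + t * I + 1 / 2) =
        Real.pi * ∑' p : ι × ℕ, legendreTerm (d p.1) p.2 (S + 1 / 2) := by
  obtain ⟨K, hK, hterm⟩ := exists_norm_legendreTerm_le_of_le hd₀ (show 0 < a + 1 / 2 by linarith)
  obtain ⟨B, hB, hker⟩ := exists_norm_kernel_le ha hS
  set m : ι × ℕ → ℝ := fun p => K * (Real.exp (-(a + 1 / 2) * d p.1) * Real.exp (-2 * d₀) ^ p.2)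
  have hm : Summable m := (summable_exp_mul_exp_pow hd₀ hs).mul_left K
  have hm0 : ∀ p, 0 < m p := fun p => by positivity
  -- A summable family of positive numbers has a countable index set; countability is needed to
  -- exchange sum and integral.
  have : Countable (ι × ℕ) := by
    have h := hm.countable_support
    rwa [show Function.support m = Set.univ from Set.eq_univ_of_forall fun p => (hm0 p).ne',
      Set.countable_univ_iff] at h
  set F : ι × ℕ → ℂ → ℂ := fun p w => legendreTerm (d p.1) p.2 (w + 1 / 2)
  have hF : ∀ p, DifferentiableOn ℂ (F p) {w | 0 < w.re} := fun p w hw => by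
    have hw' : 0 < (w + 1 / 2).re := by
      have : 0 < w.re := hw
      simp
      linarith
    exact (DifferentiableAt.comp (g := legendreTerm (d p.1) p.2) (f := fun w : ℂ => w + 1 / 2) w
      (differentiableAt_legendreTerm hw' _ _) (by fun_prop)).differentiableWithinAt
  have hFb : ∀ p w, a ≤ w.re → ‖F p w‖ ≤ m p * ‖w‖ ^ (-(1 / 2) : ℝ) := fun p w hw => by
    refine (hterm _ _ _ (hd p.1) (by simpa using hw)).trans ?_
    have hw0 : 0 < ‖w‖ := (ha.trans_le hw).trans_le (re_le_norm w)
    -- The decay is known in `ν = w + 1/2`, while Cauchy's formula asks for it in `w`.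
    have hle : ‖w‖ ≤ ‖w + 1 / 2‖ := by
      rw [← sq_le_sq₀ (norm_nonneg _) (norm_nonneg _), ← normSq_eq_norm_sq, ← normSq_eq_norm_sq,
        normSq_apply, normSq_apply]
      simp
      nlinarith
    exact mul_le_mul_of_nonneg_left (Real.rpow_le_rpow_of_nonpos hw0 hle (by norm_num)) (hm0 p).le
  have hcont : ∀ p, ContinuousOn (F p) {w | a ≤ w.re} := fun p =>
    (hF p).continuousOn.mono fun w hw => ha.trans_le hw
  have hint : ∀ p, Integrable fun t : ℝ =>
      (a + t * I) / (S ^ 2 - (a + t * I) ^ 2) * F p (a + t * I) := fun p =>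
    integrable_kernel_mul ha hS (hcont p) (hFb p)
  have hval : ∀ p, ∫ t : ℝ, (a + t * I) / (S ^ 2 - (a + t * I) ^ 2) * F p (a + t * I) =
      Real.pi * F p S := fun p => integral_kernel_mul ha ha hS (hF p) (hFb p)
  have hbound : ∀ p (t : ℝ), ‖(a + t * I) / (S ^ 2 - (a + t * I) ^ 2) * F p (a + t * I)‖ ≤
      m p * (B * (1 + |t|) ^ (-(3 / 2) : ℝ)) := fun p t => by
    rw [norm_mul]
    calc _ ≤ ‖(a + t * I) / (S ^ 2 - (a + t * I) ^ 2)‖ *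
          (m p * ‖(a + t * I : ℂ)‖ ^ (-(1 / 2) : ℝ)) := by
          gcongr
          exact hFb p _ (by simp)
      _ = m p * (‖(a + t * I) / (S ^ 2 - (a + t * I) ^ 2)‖ *
          ‖(a + t * I : ℂ)‖ ^ (-(1 / 2) : ℝ)) := by ring
      _ ≤ _ := mul_le_mul_of_nonneg_left (hker t) (hm0 p).le
  have hdom : Integrable fun t : ℝ => B * (1 + |t|) ^ (-(3 / 2) : ℝ) :=
    (integrable_one_add_abs_rpow (by norm_num)).const_mul B
  simp_rw [← tsum_mul_left (ι := ι × ℕ) (α := ℂ)]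
  constructor
  · refine (hdom.const_mul (∑' p, m p)).mono' (Continuous.aestronglyMeasurable ?_)
      (ae_of_all _ fun t => ?_)
    · refine continuous_tsum (u := fun p => m p * B) (fun p => ?_) (hm.mul_right B) fun p t => ?_
      · refine Continuous.mul ?_ ?_
        · exact Continuous.div (by fun_prop) (by fun_prop) (sq_sub_sq_ne_zero ha hS)
        · exact (hcont p).comp_continuous (by fun_prop) fun t => by simp
      · refine (hbound p t).trans (mul_le_mul_of_nonneg_left ?_ (hm0 p).le)
        refine mul_le_of_le_one_right hB.le ?_
        exact Real.rpow_le_one_of_one_le_of_nonpos (by linarith [abs_nonneg t]) (by norm_num)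
    · rw [← tsum_mul_right]
      exact tsum_of_norm_bounded (hm.mul_right _).hasSum fun p => hbound p t
  · have hsum : Summable fun p => ∫ t : ℝ,
        ‖(a + t * I) / (S ^ 2 - (a + t * I) ^ 2) * F p (a + t * I)‖ := by
      refine (hm.mul_right (∫ t : ℝ, B * (1 + |t|) ^ (-(3 / 2) : ℝ))).of_nonneg_of_le
        (fun p => integral_nonneg fun t => norm_nonneg _) fun p => ?_
      rw [← integral_const_mul]
      exact integral_mono (hint p).norm (hdom.const_mul _) (hbound p)
    have h := (hasSum_integral_of_summable_integral_norm hint hsum).tsum_eq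
    simp_rw [hval] at h
    exact h.symm

end Series

end Assembly

end HypGreen

/-! ### The integral representation of the Green's function. -/

open HypGreen Complex MeasureTheory in
theorem mainTheorem11 (Γ : Subgroup PSL(2, ℝ)) (hΓ : HypGreen.IsFuchsianFirstKind Γ)
    (δ : ℝ) (hδ₀ : 0 < δ) (hδ₁ : δ < 1 / 2)
    (z w : ℍ)
    (hzw : (Quotient.mk _ z : MulAction.orbitRel.Quotient Γ ℍ) ≠ Quotient.mk _ w)
    (s : ℂ) (hs : 1 + δ < s.re) :
    -- the series defining `G_s(z, w)` converges absolutely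
    (Summable fun η : Γ => HypGreen.legendreQ (s - 1) (1 + 2 * HypGreen.u z (η • w))) ∧
    -- the series defining `K_{ν + 2k}(z, w)` and `𝒦_ν(z, w)` converge absolutely on the contour
    (∀ ν : ℂ, ν.re = 1 + δ →
      (∀ k : ℕ, Summable fun η : Γ =>
        (Real.cosh (dist z (η • w)) : ℂ) ^ (-(ν + 2 * (k : ℂ)))) ∧
      Summable fun k : ℕ =>
        HypGreen.b k ν / (k.factorial : ℂ) * HypGreen.kernelK Γ (ν + 2 * (k : ℂ)) z w) ∧
    -- the contour integral converges absolutely and represents `G_s(z, w)`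
    Complex.VerticalIntegrable (HypGreen.greensIntegrand Γ s z w) (1 + δ) ∧
    HypGreen.greens Γ s z w =
      HypGreen.lineIntegral (1 + δ) (HypGreen.greensIntegrand Γ s z w) := by
  have := hΓ.discrete
  have hne : ∀ η : Γ, z ≠ η • w := fun η h => hzw (Quotient.sound ⟨η, h.symm⟩)
  obtain ⟨d₀, hd₀, hd⟩ := exists_forall_le_dist hne
  have hsum : ∀ σ : ℝ, 1 < σ → Summable fun η : Γ => Real.exp (-σ * dist z (η • w)) :=
    fun σ hσ => summable_exp_neg_mul_dist hσ z w
  have hs1 : 1 < s.re := by linarith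
  have hQ := hasSum_legendreQ hd₀ hd (ν := s) (by linarith) (hsum _ hs1)
  -- Recentring at `λ = ν - 1/2` moves the line `Re ν = 1 + δ` to `Re λ = 1/2 + δ`. The evenness of
  -- the denominator in `1/2 - ν` puts it in the form `S² - λ²`.
  have key : ∀ t : ℝ, greensIntegrand Γ s z w ((1 + δ : ℝ) + t * I) =
      (1 / (2 * Real.pi ^ 2 * I)) * (((1 / 2 + δ : ℝ) + t * I) /
        ((s - 1 / 2) ^ 2 - ((1 / 2 + δ : ℝ) + t * I) ^ 2) *
        ∑' p : Γ × ℕ, legendreTerm (dist z (p.1 • w)) p.2 ((1 / 2 + δ : ℝ) + t * I + 1 / 2)) :=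
    fun t => by
      set ν : ℂ := (1 + δ : ℝ) + t * I with hν
      have hre : ν.re = 1 + δ := by simp [hν]
      have e : ((1 / 2 + δ : ℝ) : ℂ) + t * I = ν - 1 / 2 := by
        rw [hν]
        push_cast
        ring
      have h := (hasSum_b_mul_tsum_cosh_cpow hd₀ hd (ν := ν) (by rw [hre]; linarith)
        (hsum _ (by rw [hre]; linarith))).tsum_eq
      rw [tsum_mul_left] at h
      rw [e, sub_add_cancel, greensIntegrand, calK, div_mul_eq_mul_div]
      simp only [kernelK]
      rw [h]
      ring
  obtain ⟨hint, hval⟩ := integral_kernel_mul_tsum_legendreTerm hd₀ hd (a := 1 / 2 + δ)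
    (by linarith) (hsum (1 / 2 + δ + 1 / 2) (by linarith)) (S := s - 1 / 2) (by simp; linarith)
  refine ⟨?_, fun ν hν => ⟨fun k => ?_, ?_⟩, ?_, ?_⟩
  · simpa only [cosh_dist_eq] using hQ.summable
  · exact summable_cosh_cpow hd₀ hd (by linarith) (hsum _ (by linarith)) k
  · exact summable_b_mul_tsum_cosh_cpow hd₀ hd (by linarith) (hsum _ (by linarith))
  · exact (hint.const_mul _).congr (ae_of_all _ fun t => (key t).symm)
  · rw [lineIntegral]
    simp_rw [key]
    -- The constants are `i · 1 / (2π²i) · π = 1 / (2π)`.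
    rw [integral_const_mul, hval, sub_add_cancel, greens]
    simp_rw [← cosh_dist_eq]
    rw [hQ.tsum_eq]
    have := I_ne_zero
    have hpi : (Real.pi : ℂ) ≠ 0 := ofReal_ne_zero.mpr Real.pi_ne_zero
    field_simp
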